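/- Let $\Gamma$ be a discrete group, let $P$ be a $\mathrm{II}_1$ factor with its faithful normal tracial state $\tau_P$, and let $Q$ be a finite separable von Neumann algebra with a fixed faithful normal tracial state $\tau_Q$ (separable means that $L^2(Q,\tau_Q)$ is separable). Let $\Gamma\curvearrowright^{\sigma}P$ and $\Gamma\curvearrowright^{\rho}Q$ be trace-preserving actions by $*$-automorphisms (for the factor $P$, preservation of $\tau_P$ is automatic by uniqueness of the trace). Assume that $\sigma$ is outer, i.e. for every $\gamma\neq e$ the automorphism $\sigma_\gamma$ is not of the form $\mathrm{Ad}(u)$ with $u\in\mathcal U(P)$. Let $\Gamma$ act diagonally on $P\bar\otimes Q$ by $\sigma_\gamma\otimes\rho_\gamma$, and let $(P\bar\otimes Q)\rtimes\Gamma$ be the crossed product von Neumann algebra, represented on $L^2(P,\tau_P)\otimes L^2(Q,\tau_Q)\otimes\ell^2(\Gamma)$ and generated by $(P\bar\otimes Q)\otimes 1$ and the canonical unitaries $u_\gamma$, $\gamma\in\Gamma$. Regard $P\rtimes\Gamma$ as the von Neumann subalgebra generated by $P\otimes 1\otimes 1$ and the $u_\gamma$. Then for every von Neumann algebra $N$ with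 $P\rtimes\Gamma\subseteq N\subseteq(P\bar\otimes Q)\rtimes\Gamma$ there is a $\Gamma$-invariant von Neumann subalgebra $Q_0\subseteq Q$ (with the same unit) such that $N=(P\bar\otimes Q_0)\rtimes\Gamma$, where $(P\bar\otimes Q_0)\rtimes\Gamma$ denotes the von Neumann subalgebra generated by $(P\bar\otimes Q_0)\otimes 1$ and the $u_\gamma$. -/

import Mathlib

open scoped TensorProduct ENNReal

universe u v w

noncomputable section

/-! ### Generated von Neumann algebras -/

section Generated

variable {H : Type u} [NormedAddCommGroup H] [InnerProductSpace ℂ H] [CompleteSpace H]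

/-- The von Neumann algebra `(S ∪ S*)''` on `H` generated by a set `S` of bounded operators. -/
def vnGenerated (S : Set (H →L[ℂ] H)) : VonNeumannAlgebra H where
  toStarSubalgebra :=
    StarSubalgebra.centralizer ℂ (StarSubalgebra.centralizer ℂ S : Set (H →L[ℂ] H))
  centralizer_centralizer' := by
    change Set.centralizer (Set.centralizer
      (StarSubalgebra.centralizer ℂ (StarSubalgebra.centralizer ℂ S : Set (H →L[ℂ] H)) :
        Set (H →L[ℂ] H))) =
      (StarSubalgebra.centralizer ℂ (StarSubalgebra.centralizer ℂ S : Set (H →L[ℂ] H)) :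
        Set (H →L[ℂ] H))
    rw [StarSubalgebra.coe_centralizer, Set.centralizer_centralizer_centralizer]

/-- `M` is a factor: its centre `M ∩ M'` consists of the scalars. -/
def VonNeumannAlgebra.IsFactor (M : VonNeumannAlgebra H) : Prop :=
  ∀ x ∈ M, x ∈ M.commutant → ∃ c : ℂ, x = c • (1 : H →L[ℂ] H)

/-- The elements of `M`, as a unital complex `*`-algebra. -/
abbrev VonNeumannAlgebra.Elt (M : VonNeumannAlgebra H) : Type u := M.toStarSubalgebra

/-- A faithful normal tracial state on the von Neumann algebra `M ⊆ B(H)`. A positive functional is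
normal if it is a countable sum of vector functionals `x ↦ ⟪ξₙ, x ξₙ⟫` (this also gives
positivity; inner products are conjugate linear in the first variable). -/
structure FaithfulNormalTrace (M : VonNeumannAlgebra H) where
  /-- the trace -/
  tr : M.Elt →ₗ[ℂ] ℂ
  normal : ∃ ξ : ℕ → H, ∀ x : M.Elt,
    HasSum (fun n => inner ℂ (ξ n) ((x : H →L[ℂ] H) (ξ n))) (tr x)
  map_one : tr 1 = 1
  tracial : ∀ x y : M.Elt, tr (x * y) = tr (y * x)
  faithful : ∀ x : M.Elt, tr (star x * x) = 0 → x = 0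

/-- `M` is a `II₁` factor: an infinite-dimensional factor with a faithful normal tracial state. -/
structure VonNeumannAlgebra.IsIIOneFactor (M : VonNeumannAlgebra H) : Prop where
  isFactor : M.IsFactor
  infinite_dimensional : ¬ FiniteDimensional ℂ M.Elt
  exists_trace : Nonempty (FaithfulNormalTrace M)

end Generated

/-! ### The Hilbert space `L²(M, τ)` and the standard representation -/

namespace FaithfulNormalTrace

variable {H : Type u} [NormedAddCommGroup H] [InnerProductSpace ℂ H] [CompleteSpace H]
  {M : VonNeumannAlgebra H}

theorem tr_star (τ : FaithfulNormalTrace M) (x : M.Elt) :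
    τ.tr (star x) = (starRingEnd ℂ) (τ.tr x) := by
  obtain ⟨ξ, h⟩ := τ.normal
  refine (h (star x)).unique ?_
  have h2 := (Complex.hasSum_conj' (f := fun n => inner ℂ (ξ n) ((x : H →L[ℂ] H) (ξ n)))).2 (h x)
  convert! h2 using 2 with n
  rw [inner_conj_symm, StarMemClass.coe_star, ContinuousLinearMap.star_eq_adjoint,
    ContinuousLinearMap.adjoint_inner_right]

theorem hasSum_tr_star_mul (τ : FaithfulNormalTrace M) {ξ : ℕ → H}
    (h : ∀ x : M.Elt, HasSum (fun n => inner ℂ (ξ n) ((x : H →L[ℂ] H) (ξ n))) (τ.tr x))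
    (x : M.Elt) :
    HasSum (fun n => ‖(x : H →L[ℂ] H) (ξ n)‖ ^ 2) (τ.tr (star x * x)).re := by
  have h2 := Complex.hasSum_re (h (star x * x))
  convert! h2 using 2 with n
  rw [MulMemClass.coe_mul, StarMemClass.coe_star, ContinuousLinearMap.star_eq_adjoint,
    mul_apply_eq_comp, ContinuousLinearMap.adjoint_inner_right,
    inner_self_eq_norm_sq_to_K]
  norm_cast

theorem tr_star_mul_self_im (τ : FaithfulNormalTrace M) (x : M.Elt) :
    (τ.tr (star x * x)).im = 0 := by
  have h := τ.tr_star (star x * x)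
  rw [star_mul, star_star] at h
  exact Complex.conj_eq_iff_im.1 h.symm

/-- `M`, to be equipped with the inner product `⟪x, y⟫ = τ(x* y)`. -/
@[nolint unusedArguments]
def PreL2 (_τ : FaithfulNormalTrace M) : Type u := M.Elt

instance (τ : FaithfulNormalTrace M) : AddCommGroup τ.PreL2 := inferInstanceAs (AddCommGroup M.Elt)

instance (τ : FaithfulNormalTrace M) : Module ℂ τ.PreL2 := inferInstanceAs (Module ℂ M.Elt)

/-- The identity map `M → PreL2`. -/
def toPreL2 (τ : FaithfulNormalTrace M) : M.Elt ≃ₗ[ℂ] τ.PreL2 := LinearEquiv.refl ℂ _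

/-- The inner product `⟪x, y⟫ = τ(x* y)` on `M`. -/
@[reducible] def preL2Core (τ : FaithfulNormalTrace M) : InnerProductSpace.Core ℂ τ.PreL2 where
  inner x y := τ.tr (star (τ.toPreL2.symm x) * τ.toPreL2.symm y)
  conj_inner_symm x y := by rw [← tr_star, star_mul, star_star]
  re_inner_nonneg x := by
    obtain ⟨ξ, h⟩ := τ.normal
    exact (τ.hasSum_tr_star_mul h (τ.toPreL2.symm x)).nonneg fun n => by positivity
  add_left x y z := by rw [map_add, star_add, add_mul, map_add]
  smul_left x y r := by
    rw [map_smul, star_smul, smul_mul_assoc, map_smul]; rfl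
  definite x h := τ.faithful x h

instance (τ : FaithfulNormalTrace M) : NormedAddCommGroup τ.PreL2 :=
  τ.preL2Core.toNormedAddCommGroup

instance (τ : FaithfulNormalTrace M) : InnerProductSpace ℂ τ.PreL2 :=
  InnerProductSpace.ofCore τ.preL2Core.toCore

theorem preL2_inner (τ : FaithfulNormalTrace M) (x y : M.Elt) :
    inner ℂ (τ.toPreL2 x) (τ.toPreL2 y) = τ.tr (star x * y) := rfl

theorem preL2_norm_sq (τ : FaithfulNormalTrace M) (x : M.Elt) :
    ‖τ.toPreL2 x‖ ^ 2 = (τ.tr (star x * x)).re := by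
  rw [← preL2_inner, ← inner_self_eq_norm_sq (𝕜 := ℂ)]; rfl

/-- The Hilbert space `L²(M, τ)`. -/
abbrev L2 (τ : FaithfulNormalTrace M) : Type u := UniformSpace.Completion τ.PreL2

/-- Left multiplication by `a` on `M ⊆ L²(M, τ)`. -/
def preLeftMul (τ : FaithfulNormalTrace M) (a : M.Elt) : τ.PreL2 →L[ℂ] τ.PreL2 :=
  (τ.toPreL2.toLinearMap ∘ₗ LinearMap.mulLeft ℂ a ∘ₗ τ.toPreL2.symm.toLinearMap).mkContinuous
    ‖(a : H →L[ℂ] H)‖ fun x => by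
      obtain ⟨ξ, h⟩ := τ.normal
      obtain ⟨x, rfl⟩ := τ.toPreL2.surjective x
      change ‖τ.toPreL2 (a * x)‖ ≤ _
      rw [← sq_le_sq₀ (by positivity) (by positivity), mul_pow, preL2_norm_sq, preL2_norm_sq]
      refine hasSum_le (fun n => ?_) (τ.hasSum_tr_star_mul h (a * x))
        ((τ.hasSum_tr_star_mul h x).mul_left _)
      rw [← mul_pow]
      exact pow_le_pow_left₀ (norm_nonneg _) ((a : H →L[ℂ] H).le_opNorm _) 2

/-- The standard representation of `M` on `L²(M, τ)`: `a` acts by left multiplication. -/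
def leftMul (τ : FaithfulNormalTrace M) (a : M.Elt) : τ.L2 →L[ℂ] τ.L2 :=
  (τ.preLeftMul a).completion

theorem leftMul_coe (τ : FaithfulNormalTrace M) (a x : M.Elt) :
    τ.leftMul a (τ.toPreL2 x : τ.L2) = (τ.toPreL2 (a * x) : τ.L2) :=
  ContinuousLinearMap.completion_apply_coe _ _

/-- For a von Neumann subalgebra `S ⊆ M`, the von Neumann algebra on `L²(M, τ)` which is the image
of `S` in the standard representation of `M`. -/
def stdImage (τ : FaithfulNormalTrace M) (S : VonNeumannAlgebra H) : VonNeumannAlgebra τ.L2 :=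
  vnGenerated {T | ∃ a : M.Elt, (a : H →L[ℂ] H) ∈ S ∧ T = τ.leftMul a}

end FaithfulNormalTrace

/-! ### Trace-preserving actions -/

/-- An action of the discrete group `Γ` on `M` by `τ`-preserving `*`-automorphisms. -/
structure TraceAction (Γ : Type w) [Group Γ] {H : Type u} [NormedAddCommGroup H]
    [InnerProductSpace ℂ H] [CompleteSpace H] {M : VonNeumannAlgebra H}
    (τ : FaithfulNormalTrace M) where
  /-- the action -/
  aut : Γ →* (M.Elt ≃⋆ₐ[ℂ] M.Elt)
  tr_aut : ∀ (g : Γ) (x : M.Elt), τ.tr (aut g x) = τ.tr x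

namespace TraceAction

variable {Γ : Type w} [Group Γ] {H : Type u} [NormedAddCommGroup H]
  [InnerProductSpace ℂ H] [CompleteSpace H] {M : VonNeumannAlgebra H}
  {τ : FaithfulNormalTrace M}

/-- The action is outer: for `g ≠ 1` the automorphism `σ_g` is not of the form `Ad u` with `u` a
unitary of `M`. -/
def IsOuter (σ : TraceAction Γ τ) : Prop :=
  ∀ g : Γ, g ≠ 1 → ¬ ∃ u ∈ unitary M.Elt, ∀ x : M.Elt, σ.aut g x = u * x * star u

/-- `x ↦ σ_g(x)` as an isometry for the norm of `L²(M, τ)`. -/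
def preKoopman (σ : TraceAction Γ τ) (g : Γ) : τ.PreL2 →L[ℂ] τ.PreL2 :=
  (τ.toPreL2.toLinearMap ∘ₗ (σ.aut g).toAlgEquiv.toLinearMap ∘ₗ
    τ.toPreL2.symm.toLinearMap).mkContinuous 1 fun x => by
      obtain ⟨x, rfl⟩ := τ.toPreL2.surjective x
      change ‖τ.toPreL2 (σ.aut g x)‖ ≤ _
      rw [one_mul, ← sq_le_sq₀ (by positivity) (by positivity), τ.preL2_norm_sq, τ.preL2_norm_sq,
        ← map_star, ← map_mul, σ.tr_aut]

/-- The operator on `L²(M, τ)` extending `σ_g`. -/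
def koopmanOp (σ : TraceAction Γ τ) (g : Γ) : τ.L2 →L[ℂ] τ.L2 := (σ.preKoopman g).completion

theorem koopmanOp_coe (σ : TraceAction Γ τ) (g : Γ) (x : M.Elt) :
    σ.koopmanOp g (τ.toPreL2 x : τ.L2) = (τ.toPreL2 (σ.aut g x) : τ.L2) :=
  ContinuousLinearMap.completion_apply_coe _ _

theorem koopmanOp_one (σ : TraceAction Γ τ) : σ.koopmanOp 1 = 1 := by
  ext x
  induction x using UniformSpace.Completion.induction_on with
  | hp => exact isClosed_eq (by fun_prop) (by fun_prop)
  | ih x =>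
    obtain ⟨x, rfl⟩ := τ.toPreL2.surjective x
    rw [koopmanOp_coe, map_one]; rfl

theorem koopmanOp_mul (σ : TraceAction Γ τ) (g h : Γ) :
    σ.koopmanOp (g * h) = σ.koopmanOp g * σ.koopmanOp h := by
  ext x
  induction x using UniformSpace.Completion.induction_on with
  | hp => exact isClosed_eq (by fun_prop) (by fun_prop)
  | ih x =>
    obtain ⟨x, rfl⟩ := τ.toPreL2.surjective x
    rw [mul_apply_eq_comp, koopmanOp_coe, koopmanOp_coe, koopmanOp_coe, map_mul]; rfl

theorem star_koopmanOp (σ : TraceAction Γ τ) (g : Γ) :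
    star (σ.koopmanOp g) = σ.koopmanOp g⁻¹ := by
  symm
  rw [ContinuousLinearMap.star_eq_adjoint, ContinuousLinearMap.eq_adjoint_iff]
  intro x y
  induction x, y using UniformSpace.Completion.induction_on₂ with
  | hp => exact isClosed_eq (by fun_prop) (by fun_prop)
  | ih x y =>
    obtain ⟨x, rfl⟩ := τ.toPreL2.surjective x
    obtain ⟨y, rfl⟩ := τ.toPreL2.surjective y
    rw [koopmanOp_coe, koopmanOp_coe, UniformSpace.Completion.inner_coe,
      UniformSpace.Completion.inner_coe, τ.preL2_inner, τ.preL2_inner,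
      ← σ.tr_aut g (star _ * y), map_mul, map_star, ← StarAlgEquiv.mul_apply, ← map_mul,
      mul_inv_cancel, map_one, StarAlgEquiv.one_apply]

/-- The unitary representation of `Γ` on `L²(M, τ)` given by `σ`. It implements the action:
`U_g a U_g* = σ_g(a)` in the standard representation. -/
def koopman (σ : TraceAction Γ τ) : Γ →* unitary (τ.L2 →L[ℂ] τ.L2) where
  toFun g := ⟨σ.koopmanOp g, by
    rw [Unitary.mem_iff, star_koopmanOp, ← koopmanOp_mul, ← koopmanOp_mul, inv_mul_cancel,
      mul_inv_cancel, koopmanOp_one]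
    exact ⟨rfl, rfl⟩⟩
  map_one' := Subtype.ext σ.koopmanOp_one
  map_mul' g h := Subtype.ext (σ.koopmanOp_mul g h)

end TraceAction

/-! ### Tensor products -/

section Tensor

variable {L₁ : Type u} {L₂ : Type v} [NormedAddCommGroup L₁] [InnerProductSpace ℂ L₁]
  [NormedAddCommGroup L₂] [InnerProductSpace ℂ L₂]

/-- The Hilbert space tensor product. -/
abbrev HilbertTensor (L₁ : Type u) (L₂ : Type v) [NormedAddCommGroup L₁] [InnerProductSpace ℂ L₁]
    [NormedAddCommGroup L₂] [InnerProductSpace ℂ L₂] : Type (max u v) :=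
  UniformSpace.Completion (L₁ ⊗[ℂ] L₂)

/-- The bounded operator `a ⊗ b` on the Hilbert space tensor product. -/
def opTensor (a : L₁ →L[ℂ] L₁) (b : L₂ →L[ℂ] L₂) :
    HilbertTensor L₁ L₂ →L[ℂ] HilbertTensor L₁ L₂ :=
  (TensorProduct.mapL a b).completion

theorem opTensor_coe (a : L₁ →L[ℂ] L₁) (b : L₂ →L[ℂ] L₂) (x : L₁ ⊗[ℂ] L₂) :
    opTensor a b (x : HilbertTensor L₁ L₂) = (TensorProduct.mapL a b x : L₁ ⊗[ℂ] L₂) :=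
  ContinuousLinearMap.completion_apply_coe _ _

theorem opTensor_one :
    opTensor (1 : L₁ →L[ℂ] L₁) (1 : L₂ →L[ℂ] L₂) = 1 := by
  ext x
  induction x using UniformSpace.Completion.induction_on with
  | hp => exact isClosed_eq (by fun_prop) (by fun_prop)
  | ih x =>
    rw [opTensor_coe]
    exact congrArg _ (DFunLike.congr_fun (TensorProduct.mapL_id_id (𝕜 := ℂ) (E := L₁) (G := L₂)) x)

theorem opTensor_mul (a a' : L₁ →L[ℂ] L₁) (b b' : L₂ →L[ℂ] L₂) :
    opTensor (a * a') (b * b') = opTensor a b * opTensor a' b' := by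
  ext x
  induction x using UniformSpace.Completion.induction_on with
  | hp => exact isClosed_eq (by fun_prop) (by fun_prop)
  | ih x =>
    rw [mul_apply_eq_comp, opTensor_coe, opTensor_coe, opTensor_coe,
      TensorProduct.mapL_mul]
    rfl

theorem star_opTensor [CompleteSpace L₁] [CompleteSpace L₂] (a : L₁ →L[ℂ] L₁)
    (b : L₂ →L[ℂ] L₂) : star (opTensor a b) = opTensor (star a) (star b) := by
  symm
  rw [ContinuousLinearMap.star_eq_adjoint, ContinuousLinearMap.star_eq_adjoint,
    ContinuousLinearMap.star_eq_adjoint, ContinuousLinearMap.eq_adjoint_iff]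
  intro x y
  induction x, y using UniformSpace.Completion.induction_on₂ with
  | hp => exact isClosed_eq (by fun_prop) (by fun_prop)
  | ih x y =>
    rw [opTensor_coe, opTensor_coe, UniformSpace.Completion.inner_coe,
      UniformSpace.Completion.inner_coe]
    induction x with
    | zero => simp
    | add x x' hx hx' => rw [map_add, inner_add_left, inner_add_left, hx, hx']
    | tmul x₁ x₂ =>
      induction y with
      | zero => simp
      | add y y' hy hy' => rw [map_add, inner_add_right, inner_add_right, hy, hy']
      | tmul y₁ y₂ =>
        rw [TensorProduct.mapL_tmul, TensorProduct.mapL_tmul, TensorProduct.inner_tmul,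
          TensorProduct.inner_tmul, ContinuousLinearMap.adjoint_inner_left,
          ContinuousLinearMap.adjoint_inner_left]

variable [CompleteSpace L₁] [CompleteSpace L₂]

/-- The tensor product `g ↦ U_g ⊗ V_g` of two unitary representations. -/
def repTensor {Γ : Type w} [Group Γ] (U : Γ →* unitary (L₁ →L[ℂ] L₁))
    (V : Γ →* unitary (L₂ →L[ℂ] L₂)) :
    Γ →* unitary (HilbertTensor L₁ L₂ →L[ℂ] HilbertTensor L₁ L₂) where
  toFun g := ⟨opTensor (U g) (V g), by
    rw [Unitary.mem_iff, star_opTensor, ← opTensor_mul, ← opTensor_mul,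
      Unitary.star_mul_self_of_mem (U g).2, Unitary.star_mul_self_of_mem (V g).2,
      Unitary.mul_star_self_of_mem (U g).2, Unitary.mul_star_self_of_mem (V g).2, opTensor_one]
    exact ⟨rfl, rfl⟩⟩
  map_one' := Subtype.ext <| by
    change opTensor ((U 1 : unitary _) : L₁ →L[ℂ] L₁) ((V 1 : unitary _) : L₂ →L[ℂ] L₂) = 1
    rw [map_one, map_one]; exact opTensor_one
  map_mul' g h := Subtype.ext <| by
    change opTensor ((U (g * h) : unitary _) : L₁ →L[ℂ] L₁)
      ((V (g * h) : unitary _) : L₂ →L[ℂ] L₂) = opTensor _ _ * opTensor _ _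
    rw [map_mul, map_mul]; exact opTensor_mul _ _ _ _

/-- The von Neumann algebra tensor product `A ⊗̄ B` on `L₁ ⊗ L₂`, generated by all `a ⊗ b`. -/
def vnTensor (A : VonNeumannAlgebra L₁) (B : VonNeumannAlgebra L₂) :
    VonNeumannAlgebra (HilbertTensor L₁ L₂) :=
  vnGenerated {T | ∃ a ∈ A, ∃ b ∈ B, T = opTensor a b}

/-- The copy `A ⊗ 1` of `A` on `L₁ ⊗ L₂`. -/
def vnTensorOne (A : VonNeumannAlgebra L₁) (L₂ : Type v) [NormedAddCommGroup L₂]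
    [InnerProductSpace ℂ L₂] : VonNeumannAlgebra (HilbertTensor L₁ L₂) :=
  vnGenerated {T | ∃ a ∈ A, T = opTensor a 1}

end Tensor

/-! ### Crossed products -/

section CrossedProduct

variable {Γ : Type w} [Group Γ] {L : Type u} [NormedAddCommGroup L] [InnerProductSpace ℂ L]

/-- The Hilbert space `L ⊗ ℓ²(Γ) = ℓ²(Γ, L)`. -/
abbrev L2Group (Γ : Type w) (L : Type u) [NormedAddCommGroup L] : Type (max u w) :=
  lp (fun _ : Γ => L) 2

theorem summable_twistTranslate (T : L →L[ℂ] L) (g : Γ) (f : L2Group Γ L) :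
    Summable (fun s : Γ => ‖T (f (g⁻¹ * s))‖ ^ 2) ∧
      ∑' s : Γ, ‖T (f (g⁻¹ * s))‖ ^ 2 ≤ (‖T‖ * ‖f‖) ^ 2 := by
  have h0 : HasSum (fun s : Γ => ‖f s‖ ^ 2) (‖f‖ ^ 2) := by
    have h := lp.hasSum_norm (p := 2) (by norm_num) f
    simpa only [ENNReal.toReal_ofNat, Real.rpow_ofNat] using h
  have h1 : HasSum (fun s : Γ => ‖f (g⁻¹ * s)‖ ^ 2) (‖f‖ ^ 2) :=
    (Equiv.hasSum_iff (f := fun s : Γ => ‖f s‖ ^ 2) (Equiv.mulLeft g⁻¹)).2 h0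
  have h2 := h1.mul_left (‖T‖ ^ 2)
  have hle : ∀ s : Γ, ‖T (f (g⁻¹ * s))‖ ^ 2 ≤ ‖T‖ ^ 2 * ‖f (g⁻¹ * s)‖ ^ 2 := fun s => by
    rw [← mul_pow]
    exact pow_le_pow_left₀ (norm_nonneg _) (T.le_opNorm _) 2
  have hs : Summable (fun s : Γ => ‖T (f (g⁻¹ * s))‖ ^ 2) :=
    Summable.of_nonneg_of_le (fun s => by positivity) hle h2.summable
  refine ⟨hs, ?_⟩
  rw [mul_pow]
  exact hasSum_le hle hs.hasSum h2

/-- The bounded operator `T ⊗ λ_g` on `ℓ²(Γ, L)`, where `λ` is the left regular representation: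
`((T ⊗ λ_g) f)(s) = T (f (g⁻¹ s))`. -/
def twistTranslate (T : L →L[ℂ] L) (g : Γ) : L2Group Γ L →L[ℂ] L2Group Γ L :=
  LinearMap.mkContinuous
    { toFun := fun f => ⟨fun s => T (f (g⁻¹ * s)),
        memℓp_gen (by simpa using (summable_twistTranslate T g f).1)⟩
      map_add' := fun f f' => by ext s; exact map_add T _ _
      map_smul' := fun c f => by ext s; exact map_smul T c _ }
    ‖T‖ fun f => by
      refine lp.norm_le_of_tsum_le (p := 2) (by norm_num) (by positivity) ?_
      simpa using (summable_twistTranslate T g f).2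

theorem twistTranslate_apply (T : L →L[ℂ] L) (g : Γ) (f : L2Group Γ L) (s : Γ) :
    twistTranslate T g f s = T (f (g⁻¹ * s)) := rfl

variable [CompleteSpace L]

/-- The crossed product `A ⋊ Γ` of a von Neumann algebra `A ⊆ B(L)` by the action
`g ↦ Ad U_g` of `Γ`, where `U` is a unitary representation of `Γ` on `L` with `U_g A U_g* = A`: the
von Neumann algebra on `L ⊗ ℓ²(Γ)` generated by the operators `a ⊗ 1`, `a ∈ A`, and the
canonical unitaries `u_g = U_g ⊗ λ_g`. -/
def crossedProduct (A : VonNeumannAlgebra L) (U : Γ →* unitary (L →L[ℂ] L)) :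
    VonNeumannAlgebra (L2Group Γ L) :=
  vnGenerated ({T | ∃ a ∈ A, T = twistTranslate a 1} ∪
    {T | ∃ g : Γ, T = twistTranslate (U g : L →L[ℂ] L) g})

end CrossedProduct

end

/-! Write M = (P ⊗̄ Q) ⋊ Γ, let Ω be the vector δ_1 ⊗ (1̂ ⊗ 1̂), and let Q₀ be the set of b in Q
whose copy in M lies in N. That (P ⊗̄ Q₀) ⋊ Γ lies in N is seen on generators. For the converse, let
b ∈ Q and let E_N be the trace-preserving expectation of M onto N. Since b commutes with P ⊆ N, so
does E_N(b) (`IsTraceVector.expectation_commutes`). The relative commutant of P in M is Q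
(`exists_eq_of_commutes`): if x commutes with P, its Fourier coefficients satisfy σ_{s⁻¹}(a) b_s =
b_s a; slicing over Q reduces this to elements of P, where outerness and factoriality give b_s = 0
for s ≠ 1 (`TraceAction.IsOuter.eq_zero`), and b_1 commutes with P, hence lies in 1 ⊗ Q. So E_N(b) ∈
N ∩ Q = Q₀.

Put R = (P ⊗̄ Q₀) ⋊ Γ. For x ∈ N the difference z = x - E_R(x) satisfies ⟨a u_g b Ω, zΩ⟩ = ⟨a u_g
E_N(b) Ω, zΩ⟩ = 0. The vectors a u_g b Ω are total and Ω is separating, so z = 0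
(`IsTraceVector.le_of_expectation`). No continuity of E_N is needed.

The rest supplies the trace and the expectations. That Ω is tracial on the whole bicommutant M
follows from the density of vectors dΩ for which right multiplication by d is bounded
(`isTraceVector_of_dense`), a condition that passes to tensor and crossed products. The expectation
of x is its compression to the closure of NΩ: the commutation theorem
`IsTraceVector.mem_of_commutes_right` places it in the von Neumann algebra generated by the
restriction of N, and `exists_eq_of_mem_vnGenerated` shows that this restriction is already a von
Neumann algebra. -/

noncomputable section

/-! ### Bicommutants and their transport along intertwining operators -/

section Generation

variable {H : Type u} [NormedAddCommGroup H] [InnerProductSpace ℂ H] [CompleteSpace H]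
  {K : Type v} [NormedAddCommGroup K] [InnerProductSpace ℂ K] [CompleteSpace K]

theorem VonNeumannAlgebra.smul_mem (M : VonNeumannAlgebra H) (c : ℂ) {x : H →L[ℂ] H}
    (hx : x ∈ M) : c • x ∈ M :=
  M.toStarSubalgebra.smul_mem hx c

theorem VonNeumannAlgebra.mem_of_commutes (M : VonNeumannAlgebra H) {x : H →L[ℂ] H}
    (h : ∀ T ∈ M.commutant, T * x = x * T) : x ∈ M := by
  rw [← M.commutant_commutant, mem_commutant_iff]
  exact h

theorem VonNeumannAlgebra.commutes (M : VonNeumannAlgebra H) {x T : H →L[ℂ] H}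
    (hx : x ∈ M) (hT : T ∈ M.commutant) (v : H) : x (T v) = T (x v) :=
  DFunLike.congr_fun (mem_commutant_iff.1 hT x hx) v

theorem mem_vnGenerated {S : Set (H →L[ℂ] H)} {x : H →L[ℂ] H} :
    x ∈ vnGenerated S ↔
      ∀ T : H →L[ℂ] H, (∀ s ∈ S, s * T = T * s ∧ star s * T = T * star s) → T * x = x * T := by
  change x ∈ StarSubalgebra.centralizer ℂ (StarSubalgebra.centralizer ℂ S : Set (H →L[ℂ] H)) ↔ _
  rw [StarSubalgebra.mem_centralizer_iff]
  constructor
  · intro h T hT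
    exact (h T (StarSubalgebra.mem_centralizer_iff ℂ |>.2 hT)).1
  · intro h T hT
    exact ⟨h T (StarSubalgebra.mem_centralizer_iff ℂ |>.1 hT),
      h (star T) (StarSubalgebra.mem_centralizer_iff ℂ |>.1 (star_mem hT))⟩

theorem subset_vnGenerated {S : Set (H →L[ℂ] H)} {x : H →L[ℂ] H} (hx : x ∈ S) :
    x ∈ vnGenerated S :=
  mem_vnGenerated.2 fun _ hT => (hT x hx).1.symm

theorem vnGenerated_le {S : Set (H →L[ℂ] H)} {M : VonNeumannAlgebra H} (h : ∀ s ∈ S, s ∈ M) :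
    vnGenerated S ≤ M := by
  intro x hx
  refine M.mem_of_commutes fun T hT => mem_vnGenerated.1 hx T fun s hs => ?_
  rw [VonNeumannAlgebra.mem_commutant_iff] at hT
  exact ⟨hT s (h s hs), hT _ (star_mem (h s hs))⟩

theorem mem_commutant_vnGenerated {S : Set (H →L[ℂ] H)} {T : H →L[ℂ] H}
    (h : ∀ s ∈ S, s * T = T * s ∧ star s * T = T * star s) : T ∈ (vnGenerated S).commutant :=
  VonNeumannAlgebra.mem_commutant_iff.2 fun _ hx => (mem_vnGenerated.1 hx T h).symm

/-- `j` intertwines `c` with `d` and `c*` with `d*`. -/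
def Intertwines (j : H →L[ℂ] K) (c : H →L[ℂ] H) (d : K →L[ℂ] K) : Prop :=
  (∀ v, j (c v) = d (j v)) ∧ ∀ v, j (star c v) = star d (j v)

theorem Intertwines.adjoint {j : H →L[ℂ] K} {c : H →L[ℂ] H} {d : K →L[ℂ] K}
    (h : Intertwines j c d) : Intertwines (ContinuousLinearMap.adjoint j) d c := by
  constructor
  · intro v
    refine ext_inner_left ℂ fun w => ?_
    rw [ContinuousLinearMap.adjoint_inner_right, ← ContinuousLinearMap.adjoint_inner_left d,
      ← ContinuousLinearMap.star_eq_adjoint, ← h.2, ContinuousLinearMap.star_eq_adjoint,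
      ← ContinuousLinearMap.adjoint_inner_right, ContinuousLinearMap.adjoint_inner_left]
  · intro v
    refine ext_inner_left ℂ fun w => ?_
    rw [ContinuousLinearMap.adjoint_inner_right, ContinuousLinearMap.star_eq_adjoint,
      ContinuousLinearMap.star_eq_adjoint, ContinuousLinearMap.adjoint_inner_right,
      ContinuousLinearMap.adjoint_inner_right, ContinuousLinearMap.adjoint_inner_right, h.1]

/-- The ranges of the operators in `I` span a dense subspace. -/
def JointlyTotal (I : Set (H →L[ℂ] K)) : Prop :=
  ∀ w : K, (∀ j ∈ I, ∀ v, inner ℂ (j v) w = 0) → w = 0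

omit [CompleteSpace H] in
theorem JointlyTotal.eq {I : Set (H →L[ℂ] K)} (hI : JointlyTotal I) {X Y : K →L[ℂ] K}
    (h : ∀ i ∈ I, ∀ j ∈ I, ∀ v v', inner ℂ (i v) (X (j v')) = inner ℂ (i v) (Y (j v'))) :
    X = Y := by
  have h1 : ∀ j ∈ I, ∀ v', X (j v') = Y (j v') := fun j hj v' => sub_eq_zero.1 <|
    hI _ fun i hi v => by rw [inner_sub_right, h i hi j hj, sub_self]
  ext w
  refine ext_inner_left ℂ fun w' => ?_
  rw [← ContinuousLinearMap.adjoint_inner_left, ← ContinuousLinearMap.adjoint_inner_left]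
  congr 1
  refine sub_eq_zero.1 <| hI _ fun j hj v => ?_
  rw [inner_sub_right, ContinuousLinearMap.adjoint_inner_right,
    ContinuousLinearMap.adjoint_inner_right, h1 j hj, sub_self]

/-- If T commutes with S' and its adjoints, then every i* T j with i, j ∈ I commutes with S and its
adjoints, hence with c; since I is total, these identities say that T commutes with d. This replaces
normality arguments for amplifications, unitary conjugations and the standard representation. -/
theorem JointlyTotal.mem_vnGenerated {I : Set (H →L[ℂ] K)} (hI : JointlyTotal I)
    {S : Set (H →L[ℂ] H)} {S' : Set (K →L[ℂ] K)}
    (hS : ∀ s ∈ S, ∃ s' ∈ S', ∀ j ∈ I, Intertwines j s s') {c : H →L[ℂ] H} {d : K →L[ℂ] K}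
    (hc : c ∈ vnGenerated S) (hcd : ∀ j ∈ I, Intertwines j c d) : d ∈ vnGenerated S' := by
  rw [_root_.mem_vnGenerated] at hc ⊢
  intro T hT
  refine hI.eq fun i hi j hj v v' => ?_
  have key := hc (ContinuousLinearMap.adjoint i ∘L T ∘L j) fun s hs => by
    obtain ⟨s', hs', h⟩ := hS s hs
    constructor
    · ext x
      have := DFunLike.congr_fun (hT s' hs').1 (j x)
      simp only [mul_apply_eq_comp, ContinuousLinearMap.comp_apply] at this ⊢
      rw [(h j hj).1, ← this, (h i hi).adjoint.1]
    · ext x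
      have := DFunLike.congr_fun (hT s' hs').2 (j x)
      simp only [mul_apply_eq_comp, ContinuousLinearMap.comp_apply] at this ⊢
      rw [(h j hj).2, ← this, (h i hi).adjoint.2]
  have key2 := DFunLike.congr_fun key v'
  simp only [mul_apply_eq_comp, ContinuousLinearMap.comp_apply] at key2 ⊢
  rw [(hcd j hj).1, ← (hcd i hi).adjoint.1] at key2
  rw [← ContinuousLinearMap.adjoint_inner_right, key2, ContinuousLinearMap.adjoint_inner_right]

theorem VonNeumannAlgebra.isClosed (M : VonNeumannAlgebra H) :
    IsClosed (M.toStarSubalgebra : Set (H →L[ℂ] H)) := by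
  rw [VonNeumannAlgebra.coe_toStarSubalgebra, ← M.centralizer_centralizer]
  exact Set.isClosed_centralizer _

theorem VonNeumannAlgebra.mem_span_unitary (M : VonNeumannAlgebra H) {x : H →L[ℂ] H}
    (hx : x ∈ M) : x ∈ Submodule.span ℂ {y | y ∈ M ∧ star y * y = 1} := by
  have := M.isClosed
  have h := CStarAlgebra.exists_sum_four_unitary (A := M.toStarSubalgebra) ⟨x, hx⟩
  obtain ⟨y, c, h, -⟩ := h
  have h2 := congrArg (Subtype.val) h
  simp only [AddSubmonoidClass.coe_finsetSum] at h2
  rw [h2]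
  refine Submodule.sum_mem _ fun i _ => Submodule.smul_mem _ _ (Submodule.subset_span ⟨?_, ?_⟩)
  · exact (y i).1.2
  · exact congrArg Subtype.val (Unitary.mem_iff.1 (y i).2).1

end Generation

/-! ### Faithful representations with von Neumann range -/

section Reduction

variable {H : Type u} [NormedAddCommGroup H] [InnerProductSpace ℂ H] [CompleteSpace H]
  {K : Type v} [NormedAddCommGroup K] [InnerProductSpace ℂ K] [CompleteSpace K]

/-- The bounded operators from the representation `π` to the identity representation. -/
def intertwiners (M : VonNeumannAlgebra H) (π : M.Elt →⋆ₐ[ℂ] (K →L[ℂ] K)) :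
    Set (K →L[ℂ] H) :=
  {W | ∀ m : M.Elt, ∀ v, W (π m v) = (m : H →L[ℂ] H) (W v)}

theorem intertwines_of_mem_intertwiners {M : VonNeumannAlgebra H}
    {π : M.Elt →⋆ₐ[ℂ] (K →L[ℂ] K)} {W : K →L[ℂ] H} (hW : W ∈ intertwiners M π) (m : M.Elt) :
    Intertwines W (π m) m :=
  ⟨hW m, fun v => by rw [← map_star, hW]; rfl⟩

/-- For intertwiners W, W' the operator W*W' commutes with π(M), hence with y. So Wv ↦ Wyv preserves
inner products (here y*y = 1 enters) and extends to a bounded operator U on H. It commutes with M',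
because T W is again an intertwiner for T ∈ M'. Thus U ∈ M, and Wπ(U) = UW = Wy for all W gives π(U)
= y. -/
theorem exists_eq_of_isometry_mem_vnGenerated (M : VonNeumannAlgebra H)
    (π : M.Elt →⋆ₐ[ℂ] (K →L[ℂ] K)) (hπ : Function.Injective π)
    (hI : ∀ v : K, (∀ W ∈ intertwiners M π, W v = 0) → v = 0)
    {y : K →L[ℂ] K} (hy : y ∈ vnGenerated (Set.range π)) (hy1 : star y * y = 1) :
    ∃ m, π m = y := by
  classical
  let Φ : (intertwiners M π →₀ K) →ₗ[ℂ] H := Finsupp.lsum ℂ fun W => (W : K →L[ℂ] H).toLinearMap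
  let Ψ : (intertwiners M π →₀ K) →ₗ[ℂ] H :=
    Finsupp.lsum ℂ fun W => ((W : K →L[ℂ] H) ∘L y).toLinearMap
  have hΦ : ∀ W v, Φ (Finsupp.single W v) = (W : K →L[ℂ] H) v := fun W v => by
    simp [Φ]
  have hΨ : ∀ W v, Ψ (Finsupp.single W v) = (W : K →L[ℂ] H) (y v) := fun W v => by
    simp [Ψ]
  have hcomm : ∀ W W' : intertwiners M π, ∀ v,
      ContinuousLinearMap.adjoint (W : K →L[ℂ] H) ((W' : K →L[ℂ] H) (y v)) =
        y (ContinuousLinearMap.adjoint (W : K →L[ℂ] H) ((W' : K →L[ℂ] H) v)) := by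
    intro W W' v
    have := mem_vnGenerated.1 hy
      (ContinuousLinearMap.adjoint (W : K →L[ℂ] H) ∘L (W' : K →L[ℂ] H)) ?_
    · exact DFunLike.congr_fun this v
    · rintro _ ⟨m, rfl⟩
      have h1 := intertwines_of_mem_intertwiners W.2 m
      have h2 := intertwines_of_mem_intertwiners W'.2 m
      constructor
      · ext x
        simp only [mul_apply_eq_comp, ContinuousLinearMap.comp_apply]
        rw [h2.1, h1.adjoint.1]
      · ext x
        simp only [mul_apply_eq_comp, ContinuousLinearMap.comp_apply]
        rw [h2.2, h1.adjoint.2]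
  have hinner : ∀ f g, inner ℂ (Ψ f) (Ψ g) = inner ℂ (Φ f) (Φ g) := by
    intro f g
    induction f using Finsupp.induction_linear with
    | zero => simp
    | add f f' hf hf' => rw [map_add, map_add, inner_add_left, inner_add_left, hf, hf']
    | single W v =>
      induction g using Finsupp.induction_linear with
      | zero => simp
      | add f f' hf hf' => rw [map_add, map_add, inner_add_right, inner_add_right, hf, hf']
      | single W' v' =>
        rw [hΦ, hΦ, hΨ, hΨ, ← ContinuousLinearMap.adjoint_inner_right, hcomm,
          ← ContinuousLinearMap.adjoint_inner_left, ← ContinuousLinearMap.star_eq_adjoint,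
          ← mul_apply_eq_comp, hy1, ContinuousLinearMap.adjoint_inner_right]
        rfl
  have hnorm : ∀ f, ‖Ψ f‖ ≤ 1 * ‖Φ f‖ := fun f => by
    rw [one_mul, @norm_eq_sqrt_re_inner ℂ, @norm_eq_sqrt_re_inner ℂ _ _ _ _ (Φ f), hinner]
  have hleft : ∀ T ∈ M.commutant, ∀ W ∈ intertwiners M π, T ∘L W ∈ intertwiners M π := by
    intro T hT W hW m v
    rw [ContinuousLinearMap.comp_apply, hW, ← M.commutes m.2 hT]; rfl
  have hdense : DenseRange Φ := by
    have : (LinearMap.range Φ).topologicalClosure = ⊤ := by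
      rw [Submodule.topologicalClosure_eq_top_iff, Submodule.eq_bot_iff]
      set q := (LinearMap.range Φ)ᗮ with hq
      have hqW : ∀ x, x ∈ q ↔ ∀ W : intertwiners M π, ∀ v, inner ℂ ((W : K →L[ℂ] H) v) x = 0 := by
        intro x
        rw [hq, Submodule.mem_orthogonal]
        constructor
        · intro h W v
          exact h _ ⟨Finsupp.single W v, hΦ W v⟩
        · rintro h _ ⟨f, rfl⟩
          induction f using Finsupp.induction_linear with
          | zero => simp
          | add f g hf hg => rw [map_add, inner_add_left, hf, hg, add_zero]
          | single W v => rw [hΦ, h]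
      -- The span of the ranges of the intertwiners is M'-invariant, hence so is its orthogonal
      -- complement q.
      have hproj : q.starProjection ∈ M := by
        refine M.mem_of_commutes fun T hT => ?_
        have hinv : ∀ T ∈ M.commutant, ∀ x ∈ q, T x ∈ q := by
          intro T hT x hx
          rw [hqW] at hx ⊢
          intro W v
          rw [← ContinuousLinearMap.adjoint_inner_left]
          exact hx ⟨_, hleft _ (star_mem hT) W W.2⟩ v
        ext x
        simp only [mul_apply_eq_comp]
        refine (Submodule.eq_starProjection_of_mem_of_inner_eq_zero
          (hinv T hT _ (q.starProjection_apply_mem x)) fun w hw => ?_).symm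
        rw [← map_sub, ← ContinuousLinearMap.adjoint_inner_right]
        exact Submodule.inner_left_of_mem_orthogonal (hinv _ (star_mem hT) w hw)
          (q.sub_starProjection_mem_orthogonal x)
      -- Every W maps into the complement of q, so W π(q) = q W = 0; faithfulness of π then kills q.
      have h0 : π ⟨q.starProjection, hproj⟩ = 0 := by
        ext v
        refine hI _ fun W hW => ?_
        rw [hW]
        change q.starProjection (W v) = 0
        rw [Submodule.starProjection_apply_eq_zero_iff, Submodule.mem_orthogonal]
        intro x hx
        rw [inner_eq_zero_symm]
        exact (hqW x).1 hx ⟨W, hW⟩ v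
      have h1 : q.starProjection = 0 := congrArg Subtype.val (hπ (h0.trans (map_zero π).symm))
      intro x hx
      rw [← Submodule.starProjection_eq_self_iff.2 hx, h1]; rfl
    have h := Submodule.dense_iff_topologicalClosure_eq_top.2 this
    rwa [LinearMap.coe_range] at h
  let U : H →L[ℂ] H := Ψ.extendOfNorm Φ
  have hU : ∀ (W : intertwiners M π) v, U ((W : K →L[ℂ] H) v) = (W : K →L[ℂ] H) (y v) := by
    intro W v
    rw [← hΦ, ← hΨ]
    exact LinearMap.extendOfNorm_eq hdense ⟨1, hnorm⟩ _
  have hUM : U ∈ M := by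
    refine M.mem_of_commutes fun T hT => ?_
    refine ContinuousLinearMap.coeFn_injective
      (hdense.equalizer (T * U).continuous (U * T).continuous (funext fun f => ?_))
    simp only [Function.comp_apply, mul_apply_eq_comp]
    induction f using Finsupp.induction_linear with
    | zero => simp
    | add f g hf hg => simp only [map_add, hf, hg]
    | single W v =>
      rw [hΦ, hU]
      exact (hU ⟨_, hleft T hT W W.2⟩ v).symm
  refine ⟨⟨U, hUM⟩, ?_⟩
  ext v
  refine sub_eq_zero.1 (hI _ fun W hW => ?_)
  rw [map_sub, hW, sub_eq_zero]
  exact hU ⟨W, hW⟩ v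

/-- A faithful representation of `M` whose space is separated by bounded intertwiners into the
space of `M` has a range which is a von Neumann algebra. -/
theorem exists_eq_of_mem_vnGenerated (M : VonNeumannAlgebra H)
    (π : M.Elt →⋆ₐ[ℂ] (K →L[ℂ] K)) (hπ : Function.Injective π)
    (hI : ∀ v : K, (∀ W ∈ intertwiners M π, W v = 0) → v = 0)
    {y : K →L[ℂ] K} (hy : y ∈ vnGenerated (Set.range π)) : ∃ m, π m = y := by
  have h := (vnGenerated (Set.range π)).mem_span_unitary hy
  clear hy
  induction h using Submodule.span_induction with
  | mem x hx => exact exists_eq_of_isometry_mem_vnGenerated M π hπ hI hx.1 hx.2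
  | zero => exact ⟨0, map_zero π⟩
  | add x y _ _ hx hy =>
    obtain ⟨m, rfl⟩ := hx
    obtain ⟨n, rfl⟩ := hy
    exact ⟨m + n, map_add π m n⟩
  | smul c x _ hx =>
    obtain ⟨m, rfl⟩ := hx
    exact ⟨c • m, map_smul π c m⟩

end Reduction

/-! ### Cyclic trace vectors and the commutation theorem -/

section TraceVector

variable {H : Type u} [NormedAddCommGroup H] [InnerProductSpace ℂ H]

theorem norm_le_of_dense_of_inner_le {S : Set H} (hS : Dense S) {v : H} {C : ℝ}
    (hC : 0 ≤ C) (h : ∀ y ∈ S, ‖inner ℂ y v‖ ≤ C * ‖y‖) : ‖v‖ ≤ C := by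
  have hcl : IsClosed {y : H | ‖inner ℂ y v‖ ≤ C * ‖y‖} :=
    isClosed_le (by fun_prop) (by fun_prop)
  have hv : ‖inner ℂ v v‖ ≤ C * ‖v‖ := by
    have : v ∈ closure S := hS v
    exact closure_minimal (fun y hy => h y hy) hcl this
  rw [inner_self_eq_norm_sq_to_K, norm_pow, RCLike.norm_ofReal, abs_norm, sq] at hv
  rcases (norm_nonneg v).eq_or_lt with h0 | h0
  · rwa [← h0]
  · exact le_of_mul_le_mul_right hv h0

variable [CompleteSpace H]

theorem inner_star_left (x : H →L[ℂ] H) (v w : H) : inner ℂ (star x v) w = inner ℂ v (x w) :=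
  ContinuousLinearMap.adjoint_inner_left x w v

theorem inner_star_right (x : H →L[ℂ] H) (v w : H) : inner ℂ v (star x w) = inner ℂ (x v) w :=
  ContinuousLinearMap.adjoint_inner_right x v w

/-- `Ω` is cyclic for `M`, and the vector functional of `Ω` is tracial on `M`. -/
structure IsTraceVector (M : VonNeumannAlgebra H) (Ω : H) : Prop where
  dense : Dense {v | ∃ x ∈ M, x Ω = v}
  tracial : ∀ x ∈ M, ∀ y ∈ M, inner ℂ Ω (x (y Ω)) = inner ℂ Ω (y (x Ω))

namespace IsTraceVector

variable {M : VonNeumannAlgebra H} {Ω : H} (h : IsTraceVector M Ω)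
include h

theorem norm_star_apply {x : H →L[ℂ] H} (hx : x ∈ M) : ‖star x Ω‖ = ‖x Ω‖ := by
  rw [@norm_eq_sqrt_re_inner ℂ, @norm_eq_sqrt_re_inner ℂ _ _ _ _ (x Ω), inner_star_left,
    h.tracial x hx _ (star_mem hx), inner_star_right]

/-- Boundedness of right multiplication: by traciality ‖y x*Ω‖ = ‖x y*Ω‖ ≤ ‖x‖ ‖y*Ω‖ = ‖x‖ ‖yΩ‖. -/
theorem norm_apply_star_apply_le {x y : H →L[ℂ] H} (hx : x ∈ M) (hy : y ∈ M) :
    ‖y (star x Ω)‖ ≤ ‖x‖ * ‖y Ω‖ := by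
  have h1 := h.norm_star_apply (mul_mem hy (star_mem hx))
  rw [star_mul, star_star, mul_apply_eq_comp, mul_apply_eq_comp] at h1
  rw [← h1, ← h.norm_star_apply hy]
  exact x.le_opNorm _

theorem norm_le {v : H} {C : ℝ} (hC : 0 ≤ C) (hv : ∀ y ∈ M, ‖inner ℂ (y Ω) v‖ ≤ C * ‖y Ω‖) :
    ‖v‖ ≤ C :=
  norm_le_of_dense_of_inner_le h.dense hC fun _ ⟨y, hy, hyv⟩ => hyv ▸ hv y hy

theorem eq_zero_of_inner {v : H} (hv : ∀ y ∈ M, inner ℂ (y Ω) v = 0) : v = 0 :=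
  norm_le_zero_iff.1 <| h.norm_le le_rfl fun y hy => by rw [hv y hy, norm_zero, zero_mul]

theorem ext_inner {X Y : H →L[ℂ] H}
    (hXY : ∀ x ∈ M, ∀ y ∈ M, inner ℂ (y Ω) (X (x Ω)) = inner ℂ (y Ω) (Y (x Ω))) : X = Y := by
  refine ContinuousLinearMap.coeFn_injective (X.continuous.ext_on h.dense Y.continuous ?_)
  rintro _ ⟨x, hx, rfl⟩
  refine sub_eq_zero.1 (h.eq_zero_of_inner fun y hy => ?_)
  rw [inner_sub_right, hXY x hx y hy, sub_self]

/-- This is the weak form of "z commutes with right multiplication by x"; the hypothesis `hT` of the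
lemmas below asks the same of an arbitrary operator T. -/
theorem inner_apply_apply {x y z : H →L[ℂ] H} (hx : x ∈ M) (hy : y ∈ M) (hz : z ∈ M) :
    inner ℂ (y Ω) (z (x Ω)) = inner ℂ (y (star x Ω)) (z Ω) := by
  have := h.tracial (star y * z) (mul_mem (star_mem hy) hz) x hx
  simp only [mul_apply_eq_comp] at this
  rw [inner_star_right] at this
  rw [this, ← inner_star_left, ← inner_star_left, star_star]

theorem eq_zero_of_apply_eq_zero {x : H →L[ℂ] H} (hx : x ∈ M) (h0 : x Ω = 0) : x = 0 := by
  refine h.ext_inner fun y hy z hz => ?_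
  rw [h.inner_apply_apply hy hz hx, h0]
  simp

/-- T - z commutes with right multiplications, so its value at xΩ is the right translate by x of its
value at Ω. -/
theorem norm_sub_apply_le {T : H →L[ℂ] H}
    (hT : ∀ x ∈ M, ∀ y ∈ M, inner ℂ (y Ω) (T (x Ω)) = inner ℂ (y (star x Ω)) (T Ω))
    {x z : H →L[ℂ] H} (hx : x ∈ M) (hz : z ∈ M) :
    ‖T (x Ω) - z (x Ω)‖ ≤ ‖x‖ * ‖T Ω - z Ω‖ := by
  refine h.norm_le (by positivity) fun y hy => ?_
  rw [inner_sub_right, hT x hx y hy, h.inner_apply_apply hx hy hz, ← inner_sub_right]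
  refine (norm_inner_le_norm _ _).trans ?_
  calc _ ≤ ‖x‖ * ‖y Ω‖ * ‖T Ω - z Ω‖ := by
        gcongr
        exact h.norm_apply_star_apply_le hx hy
    _ = _ := by ring

theorem norm_star_sub_star_apply_le {T : H →L[ℂ] H} {z : H →L[ℂ] H}
    (hT : ∀ x ∈ M, ∀ y ∈ M, inner ℂ (y Ω) (T (x Ω)) = inner ℂ (y (star x Ω)) (T Ω))
    (hz : z ∈ M) : ‖star T Ω - star z Ω‖ ≤ ‖T Ω - z Ω‖ := by
  refine h.norm_le (by positivity) fun y hy => ?_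
  have h1 := hT y hy 1 (one_mem _)
  have h2 := h.inner_apply_apply hy (one_mem _) hz
  simp only [one_apply_eq_self] at h1 h2
  rw [inner_sub_right, inner_star_right, inner_star_right, ← inner_sub_left, norm_inner_symm,
    inner_sub_right, h1, h2, ← inner_sub_right, mul_comm, ← h.norm_star_apply hy]
  exact norm_inner_le_norm _ _

/-- The commutation theorem: an operator commuting with all right multiplications lies in `M`. -/
theorem mem_of_commutes_right {T : H →L[ℂ] H}
    (hT : ∀ x ∈ M, ∀ y ∈ M, inner ℂ (y Ω) (T (x Ω)) = inner ℂ (y (star x Ω)) (T Ω)) :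
    T ∈ M := by
  -- The condition passes to T*: both ⟨xΩ, T yΩ⟩ and ⟨Ω, T(y x*Ω)⟩ equal ⟨x y*Ω, TΩ⟩.
  have hT' : ∀ x ∈ M, ∀ y ∈ M,
      inner ℂ (y Ω) (star T (x Ω)) = inner ℂ (y (star x Ω)) (star T Ω) := by
    intro x hx y hy
    have h1 := hT y hy x hx
    have h2 := hT (y * star x) (mul_mem hy (star_mem hx)) 1 (one_mem _)
    simp only [star_mul, star_star, mul_apply_eq_comp, one_apply_eq_self] at h2
    rw [inner_star_right, inner_star_right, ← inner_conj_symm, h1, ← h2, inner_conj_symm]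
  refine M.mem_of_commutes fun S hS => h.ext_inner fun x hx y hy => ?_
  simp only [mul_apply_eq_comp]
  refine sub_eq_zero.1 (norm_le_zero_iff.1 (le_of_forall_pos_lt_add fun ε hε => ?_))
  -- Approximating TΩ by zΩ with z ∈ M controls both T - z and T* - z* on MΩ, and z commutes with S.
  -- The summand 1 only makes C positive.
  set C := ‖y Ω‖ * ‖S‖ * ‖x‖ + ‖y‖ * ‖S (x Ω)‖ + 1 with hC
  have hCpos : 0 < C := by positivity
  obtain ⟨_, ⟨z, hz, rfl⟩, hzT⟩ :=
    Metric.mem_closure_iff.1 (h.dense (T Ω)) (ε / C) (div_pos hε hCpos)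
  rw [dist_eq_norm] at hzT
  have e1 : inner ℂ (y Ω) (S (T (x Ω))) - inner ℂ (y Ω) (T (S (x Ω))) =
      inner ℂ (y Ω) (S (T (x Ω) - z (x Ω))) -
        inner ℂ (star T (y Ω) - star z (y Ω)) (S (x Ω)) := by
    rw [map_sub, inner_sub_right, inner_sub_left, inner_star_left, inner_star_left,
      M.commutes hz hS]
    ring
  rw [e1, zero_add]
  have b1 : ‖inner ℂ (y Ω) (S (T (x Ω) - z (x Ω)))‖ ≤ ‖y Ω‖ * ‖S‖ * ‖x‖ * ‖T Ω - z Ω‖ := by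
    refine (norm_inner_le_norm _ _).trans ?_
    rw [mul_assoc, mul_assoc]
    gcongr
    refine (S.le_opNorm _).trans ?_
    gcongr
    exact h.norm_sub_apply_le hT hx hz
  have b2 : ‖inner ℂ (star T (y Ω) - star z (y Ω)) (S (x Ω))‖ ≤
      ‖y‖ * ‖S (x Ω)‖ * ‖T Ω - z Ω‖ := by
    refine (norm_inner_le_norm _ _).trans ?_
    rw [mul_right_comm]
    gcongr
    refine (h.norm_sub_apply_le hT' hy (star_mem hz)).trans ?_
    gcongr
    exact h.norm_star_sub_star_apply_le hT hz
  calc _ ≤ (‖y Ω‖ * ‖S‖ * ‖x‖ + ‖y‖ * ‖S (x Ω)‖) * ‖T Ω - z Ω‖ := by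
        refine (norm_sub_le _ _).trans ?_
        rw [add_mul]
        exact add_le_add b1 b2
    _ ≤ C * ‖T Ω - z Ω‖ := by
        gcongr
        rw [hC]
        linarith
    _ < C * (ε / C) := by gcongr
    _ = ε := by field_simp

end IsTraceVector

end TraceVector

/-! ### Conditional expectations from the orbit of the trace vector -/

section Expectation

variable {H : Type u} [NormedAddCommGroup H] [InnerProductSpace ℂ H] [CompleteSpace H]

/-- The closure of `N Ω`. -/
def VonNeumannAlgebra.orbitClosure (N : VonNeumannAlgebra H) (Ω : H) : Submodule ℂ H :=
  (Submodule.map (ContinuousLinearMap.apply ℂ H Ω).toLinearMap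
    (Subalgebra.toSubmodule N.toStarSubalgebra.toSubalgebra)).topologicalClosure

variable {M N : VonNeumannAlgebra H} {Ω : H}

instance : CompleteSpace (N.orbitClosure Ω) :=
  (Submodule.isClosed_topologicalClosure _).completeSpace_coe

theorem VonNeumannAlgebra.coe_orbitClosure :
    (N.orbitClosure Ω : Set H) = closure {v | ∃ x ∈ N, x Ω = v} := by
  rfl

theorem VonNeumannAlgebra.apply_mem_orbitClosure {x : H →L[ℂ] H} (hx : x ∈ N) :
    x Ω ∈ N.orbitClosure Ω :=
  Submodule.le_topologicalClosure _ ⟨x, hx, rfl⟩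

theorem VonNeumannAlgebra.map_mem_orbitClosure {x : H →L[ℂ] H} (hx : x ∈ N) {v : H}
    (hv : v ∈ N.orbitClosure Ω) : x v ∈ N.orbitClosure Ω := by
  rw [← SetLike.mem_coe, coe_orbitClosure] at hv ⊢
  refine map_mem_closure x.continuous hv ?_
  rintro _ ⟨y, hy, rfl⟩
  exact ⟨x * y, mul_mem hx hy, rfl⟩

/-- The restriction of `N` to the closure of `N Ω`. -/
def VonNeumannAlgebra.orbitRep (N : VonNeumannAlgebra H) (Ω : H) :
    N.Elt →⋆ₐ[ℂ] (N.orbitClosure Ω →L[ℂ] N.orbitClosure Ω) where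
  toFun x := ((x : H →L[ℂ] H) ∘L (N.orbitClosure Ω).subtypeL).codRestrict _
    fun v => map_mem_orbitClosure x.2 v.2
  map_one' := rfl
  map_mul' _ _ := rfl
  map_zero' := rfl
  map_add' _ _ := rfl
  commutes' _ := rfl
  map_star' x := by
    rw [ContinuousLinearMap.star_eq_adjoint, ContinuousLinearMap.eq_adjoint_iff]
    intro v w
    exact inner_star_left (x : H →L[ℂ] H) (v : H) (w : H)

/-- The trace-preserving conditional expectation of `x` onto a von Neumann subalgebra. -/
theorem IsTraceVector.exists_expectation (h : IsTraceVector M Ω) (hN : N ≤ M) {x : H →L[ℂ] H}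
    (hx : x ∈ M) : ∃ n ∈ N, ∀ k ∈ N, inner ℂ (k Ω) (n Ω) = inner ℂ (k Ω) (x Ω) := by
  have hΩ : Ω ∈ N.orbitClosure Ω := VonNeumannAlgebra.apply_mem_orbitClosure (one_mem N)
  have hinj : Function.Injective (N.orbitRep Ω) := by
    refine (injective_iff_map_eq_zero _).2 fun n hn => Subtype.ext ?_
    refine h.eq_zero_of_apply_eq_zero (hN n.2) ?_
    exact congrArg Subtype.val (DFunLike.congr_fun hn ⟨Ω, hΩ⟩)
  -- The inclusion of the orbit closure is an intertwiner, and it is injective by itself.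
  have hsurj : ∀ y ∈ vnGenerated (Set.range (N.orbitRep Ω)), ∃ m, N.orbitRep Ω m = y := by
    refine fun y hy => exists_eq_of_mem_vnGenerated N _ hinj (fun v hv => ?_) hy
    exact Subtype.ext (hv (N.orbitClosure Ω).subtypeL fun m v => rfl)
  have htr : IsTraceVector (vnGenerated (Set.range (N.orbitRep Ω))) ⟨Ω, hΩ⟩ := by
    constructor
    · intro v
      have hv := v.2
      rw [← SetLike.mem_coe, VonNeumannAlgebra.coe_orbitClosure] at hv
      rw [closure_subtype]
      refine closure_mono ?_ hv
      rintro _ ⟨n, hn, rfl⟩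
      exact ⟨_, ⟨_, subset_vnGenerated ⟨⟨n, hn⟩, rfl⟩, rfl⟩, rfl⟩
    · intro x hx y hy
      obtain ⟨x, rfl⟩ := hsurj x hx
      obtain ⟨y, rfl⟩ := hsurj y hy
      exact h.tracial x (hN x.2) y (hN y.2)
  -- The compression of x to the orbit closure inherits from x the weak commutation with right
  -- multiplications by N.
  obtain ⟨n, hn⟩ := hsurj (ContinuousLinearMap.adjoint (N.orbitClosure Ω).subtypeL ∘L x ∘L
    (N.orbitClosure Ω).subtypeL) <| htr.mem_of_commutes_right fun y hy z hz => by
      obtain ⟨y, rfl⟩ := hsurj y hy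
      obtain ⟨z, rfl⟩ := hsurj z hz
      rw [← map_star]
      simp only [ContinuousLinearMap.comp_apply, ContinuousLinearMap.adjoint_inner_right]
      exact h.inner_apply_apply (hN y.2) (hN z.2) hx
  refine ⟨n, n.2, fun k hk => ?_⟩
  have h1 := congrArg (fun T => inner ℂ (N.orbitRep Ω ⟨k, hk⟩ ⟨Ω, hΩ⟩) (T ⟨Ω, hΩ⟩)) hn
  rw [ContinuousLinearMap.comp_apply, ContinuousLinearMap.adjoint_inner_right] at h1
  exact h1

end Expectation

/-! ### Traciality from a dense set of right bounded vectors -/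

section Generating

variable {H : Type u} [NormedAddCommGroup H] [InnerProductSpace ℂ H] [CompleteSpace H]
  {M : VonNeumannAlgebra H} {Ω : H}

/-- The elements `d` of `M` for which there is a bounded right multiplication by `d` in `M'`. -/
def rightBounded (M : VonNeumannAlgebra H) (Ω : H) : StarSubalgebra ℂ (H →L[ℂ] H) where
  carrier := {d | d ∈ M ∧ ∃ R ∈ M.commutant, R Ω = d Ω ∧ star R Ω = star d Ω}
  mul_mem' := by
    rintro a b ⟨ha, R, hR, h1, h2⟩ ⟨hb, R', hR', h1', h2'⟩
    refine ⟨mul_mem ha hb, R' * R, mul_mem hR' hR, ?_, ?_⟩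
    · rw [mul_apply_eq_comp, h1, ← M.commutes ha hR', h1']; rfl
    · rw [star_mul, star_mul, mul_apply_eq_comp, h2', ← M.commutes (star_mem hb) (star_mem hR),
        h2]; rfl
  one_mem' := ⟨one_mem M, 1, one_mem _, rfl, rfl⟩
  add_mem' := by
    rintro a b ⟨ha, R, hR, h1, h2⟩ ⟨hb, R', hR', h1', h2'⟩
    exact ⟨add_mem ha hb, R + R', add_mem hR hR', by simp [h1, h1'], by simp [h2, h2']⟩
  zero_mem' := ⟨zero_mem M, 0, zero_mem _, rfl, rfl⟩
  algebraMap_mem' c := by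
    rw [Algebra.algebraMap_eq_smul_one]
    exact ⟨M.smul_mem c (one_mem M), c • (1 : H →L[ℂ] H),
      VonNeumannAlgebra.smul_mem _ c (one_mem _), rfl, rfl⟩
  star_mem' := by
    rintro a ⟨ha, R, hR, h1, h2⟩
    exact ⟨star_mem ha, star R, star_mem hR, h2, by rw [star_star, star_star, h1]⟩

/-- Replace dΩ by RΩ and move R past x: this is the trace identity for d against every x in M, with
no traciality assumed. -/
theorem inner_apply_of_mem_rightBounded {d x : H →L[ℂ] H} (hd : d ∈ rightBounded M Ω)
    (hx : x ∈ M) : inner ℂ (star x Ω) (d Ω) = inner ℂ (star d Ω) (x Ω) := by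
  obtain ⟨hd, R, hR, h1, h2⟩ := hd
  rw [← h1, ← h2, inner_star_left, inner_star_left, M.commutes hx hR]

/-- The identity for right bounded d extends to all x ∈ M by approximating xΩ by dΩ. The delicate
point is that d*Ω then also approximates x*Ω, which follows by testing against right bounded
vectors. -/
theorem isTraceVector_of_dense (h : Dense {v | ∃ d ∈ rightBounded M Ω, d Ω = v}) :
    IsTraceVector M Ω := by
  have hstar : ∀ d ∈ rightBounded M Ω, ‖star d Ω‖ = ‖d Ω‖ := fun d hd => by
    have h1 := inner_apply_of_mem_rightBounded hd (star_mem hd.1)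
    rw [star_star] at h1
    rw [@norm_eq_sqrt_re_inner ℂ, @norm_eq_sqrt_re_inner ℂ _ _ _ _ (d Ω), h1]
  refine ⟨h.mono ?_, fun x hx y hy => ?_⟩
  · rintro v ⟨d, hd, hv⟩
    exact ⟨d, hd.1, hv⟩
  rw [← inner_star_left x Ω (y Ω), ← inner_star_left y Ω (x Ω)]
  have hb : ∀ d ∈ rightBounded M Ω, ‖star x Ω - star d Ω‖ ≤ ‖x Ω - d Ω‖ := by
    intro d hd
    refine norm_le_of_dense_of_inner_le h (norm_nonneg _) ?_
    rintro _ ⟨t, ht, rfl⟩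
    rw [norm_inner_symm, inner_sub_left, inner_apply_of_mem_rightBounded ht hx,
      inner_apply_of_mem_rightBounded ht hd.1, ← inner_sub_right, mul_comm, ← hstar t ht]
    exact norm_inner_le_norm _ _
  refine sub_eq_zero.1 (norm_le_zero_iff.1 (le_of_forall_pos_lt_add fun ε hε => ?_))
  set C := ‖y Ω‖ + ‖star y Ω‖ + 1 with hC
  have hCpos : 0 < C := by positivity
  obtain ⟨_, ⟨d, hd, rfl⟩, hdx⟩ :=
    Metric.mem_closure_iff.1 (h (x Ω)) (ε / C) (div_pos hε hCpos)
  rw [dist_eq_norm] at hdx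
  have hd' : inner ℂ (star d Ω) (y Ω) = inner ℂ (star y Ω) (d Ω) :=
    (inner_apply_of_mem_rightBounded hd hy).symm
  have e1 : inner ℂ (star x Ω) (y Ω) - inner ℂ (star y Ω) (x Ω) =
      inner ℂ (star x Ω - star d Ω) (y Ω) - inner ℂ (star y Ω) (x Ω - d Ω) := by
    rw [inner_sub_left, inner_sub_right, hd']
    ring
  rw [e1, zero_add]
  calc _ ≤ ‖x Ω - d Ω‖ * ‖y Ω‖ + ‖star y Ω‖ * ‖x Ω - d Ω‖ := by
        refine (norm_sub_le _ _).trans (add_le_add ?_ (norm_inner_le_norm _ _))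
        refine (norm_inner_le_norm _ _).trans ?_
        gcongr
        exact hb d hd
    _ ≤ C * ‖x Ω - d Ω‖ := by
        rw [hC]
        linarith [norm_nonneg (x Ω - d Ω)]
    _ < C * (ε / C) := by gcongr
    _ = ε := by field_simp

/-- The closure of the set of vectors `d Ω` with `d` right bounded. -/
def rightBoundedClosure (M : VonNeumannAlgebra H) (Ω : H) : Submodule ℂ H :=
  (Submodule.map (ContinuousLinearMap.apply ℂ H Ω).toLinearMap
    (Subalgebra.toSubmodule (rightBounded M Ω).toSubalgebra)).topologicalClosure

theorem isClosed_rightBoundedClosure : IsClosed (rightBoundedClosure M Ω : Set H) :=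
  Submodule.isClosed_topologicalClosure _

theorem apply_mem_rightBoundedClosure {d : H →L[ℂ] H} (hd : d ∈ rightBounded M Ω) :
    d Ω ∈ rightBoundedClosure M Ω :=
  Submodule.le_topologicalClosure _ ⟨d, hd, rfl⟩

theorem isTraceVector_of_rightBoundedClosure (h : ∀ v, v ∈ rightBoundedClosure M Ω) :
    IsTraceVector M Ω :=
  isTraceVector_of_dense h

end Generating

/-! ### The standard representation and its normality -/

namespace FaithfulNormalTrace

variable {H : Type u} [NormedAddCommGroup H] [InnerProductSpace ℂ H] [CompleteSpace H]
  {M : VonNeumannAlgebra H} (τ : FaithfulNormalTrace M)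

/-- The canonical map `M → L²(M, τ)`. -/
def hat (x : M.Elt) : τ.L2 := (τ.toPreL2 x : τ.L2)

/-- The vector `1̂` of `L²(M, τ)`. -/
def vac : τ.L2 := τ.hat 1

theorem leftMul_hat (a x : M.Elt) : τ.leftMul a (τ.hat x) = τ.hat (a * x) := τ.leftMul_coe a x

theorem leftMul_vac (a : M.Elt) : τ.leftMul a τ.vac = τ.hat a := by
  rw [vac, leftMul_hat, mul_one]

theorem inner_hat (x y : M.Elt) : inner ℂ (τ.hat x) (τ.hat y) = τ.tr (star x * y) := by
  rw [hat, hat, UniformSpace.Completion.inner_coe, preL2_inner]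

theorem hat_add (x y : M.Elt) : τ.hat (x + y) = τ.hat x + τ.hat y := by
  rw [hat, map_add]; exact UniformSpace.Completion.coe_add _ _

theorem hat_smul (c : ℂ) (x : M.Elt) : τ.hat (c • x) = c • τ.hat x := by
  rw [hat, map_smul]; exact UniformSpace.Completion.coe_smul _ _

theorem dense_hat : DenseRange τ.hat :=
  UniformSpace.Completion.denseRange_coe.comp τ.toPreL2.surjective.denseRange
    (UniformSpace.Completion.continuous_coe _)

theorem ext_hat {F : Type*} [NormedAddCommGroup F] [NormedSpace ℂ F] {S T : τ.L2 →L[ℂ] F}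
    (h : ∀ x, S (τ.hat x) = T (τ.hat x)) : S = T :=
  ContinuousLinearMap.coeFn_injective (τ.dense_hat.equalizer S.continuous T.continuous (funext h))

/-- The standard representation of `M` on `L²(M, τ)`. -/
def stdRep : M.Elt →⋆ₐ[ℂ] (τ.L2 →L[ℂ] τ.L2) where
  toFun := τ.leftMul
  map_one' := τ.ext_hat fun x => by rw [leftMul_hat, one_mul]; rfl
  map_mul' a b := τ.ext_hat fun x => by
    rw [mul_apply_eq_comp, leftMul_hat, leftMul_hat, leftMul_hat, mul_assoc]
  map_zero' := τ.ext_hat fun x => by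
    rw [leftMul_hat, zero_mul, ← zero_smul ℂ (0 : M.Elt), hat_smul, zero_smul]; rfl
  map_add' a b := τ.ext_hat fun x => by
    rw [leftMul_hat, add_mul, hat_add, add_apply, leftMul_hat, leftMul_hat]
  commutes' c := τ.ext_hat fun x => by
    rw [leftMul_hat, Algebra.algebraMap_eq_smul_one, smul_one_mul, hat_smul,
      Algebra.algebraMap_eq_smul_one]; rfl
  map_star' a := by
    rw [ContinuousLinearMap.star_eq_adjoint, ContinuousLinearMap.eq_adjoint_iff]
    refine fun v w => τ.dense_hat.induction_on₂ (p := fun v w =>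
      inner ℂ (τ.leftMul (star a) v) w = inner ℂ v (τ.leftMul a w))
      (isClosed_eq (by fun_prop) (by fun_prop)) (fun x y => ?_) v w
    rw [leftMul_hat, leftMul_hat, inner_hat, inner_hat, star_mul, star_star, mul_assoc]

theorem stdRep_hat (a x : M.Elt) : τ.stdRep a (τ.hat x) = τ.hat (a * x) := τ.leftMul_coe a x

theorem stdRep_vac (a : M.Elt) : τ.stdRep a τ.vac = τ.hat a := τ.leftMul_vac a

theorem hat_injective : Function.Injective τ.hat :=
  (UniformSpace.Completion.coe_injective _).comp τ.toPreL2.injective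

theorem stdRep_injective : Function.Injective τ.stdRep := fun a b h =>
  τ.hat_injective <| by rw [← stdRep_vac, h, stdRep_vac]

/-- ‖x ξ_n‖² is a single term of the series for τ(x*x) = ‖x̂‖², so x̂ ↦ x ξ_n is a contraction. -/
theorem exists_intertwiner {ξ : ℕ → H}
    (hξ : ∀ x : M.Elt, HasSum (fun n => inner ℂ (ξ n) ((x : H →L[ℂ] H) (ξ n))) (τ.tr x)) (n : ℕ) :
    ∃ W ∈ intertwiners M τ.stdRep, ∀ x : M.Elt, W (τ.hat x) = (x : H →L[ℂ] H) (ξ n) := by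
  let f : M.Elt →ₗ[ℂ] H :=
    { toFun := fun x => (x : H →L[ℂ] H) (ξ n)
      map_add' := fun _ _ => rfl
      map_smul' := fun _ _ => rfl }
  let e : M.Elt →ₗ[ℂ] τ.L2 :=
    { toFun := τ.hat
      map_add' := τ.hat_add
      map_smul' := τ.hat_smul }
  have hbound : ∀ x, ‖f x‖ ≤ 1 * ‖e x‖ := fun x => by
    rw [one_mul, ← sq_le_sq₀ (norm_nonneg _) (norm_nonneg _)]
    have h1 := le_hasSum (τ.hasSum_tr_star_mul hξ x) n fun j _ => by positivity
    rw [← preL2_norm_sq, ← UniformSpace.Completion.norm_coe (τ.toPreL2 x)] at h1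
    exact h1
  have hW : ∀ x : M.Elt, f.extendOfNorm e (τ.hat x) = (x : H →L[ℂ] H) (ξ n) := fun x =>
    LinearMap.extendOfNorm_eq (f := f) (e := e) τ.dense_hat ⟨1, hbound⟩ x
  refine ⟨f.extendOfNorm e, fun m v => ?_, hW⟩
  refine τ.dense_hat.induction_on (p := fun v => f.extendOfNorm e (τ.stdRep m v) =
      (m : H →L[ℂ] H) (f.extendOfNorm e v)) v (isClosed_eq (by fun_prop) (by fun_prop)) fun x => ?_
  rw [stdRep_hat, hW, hW]; rfl

theorem eq_zero_of_forall_intertwiners (v : τ.L2)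
    (hv : ∀ W ∈ intertwiners M τ.stdRep, W v = 0) : v = 0 := by
  obtain ⟨ξ, hξ⟩ := τ.normal
  choose W hWI hW using τ.exists_intertwiner hξ
  have hsum : ∀ x, HasSum (fun n => ‖W n (τ.hat x)‖ ^ 2) (‖τ.hat x‖ ^ 2) := fun x => by
    simp only [hW]
    have := τ.hasSum_tr_star_mul hξ x
    rwa [← preL2_norm_sq, ← UniformSpace.Completion.norm_coe (τ.toPreL2 x)] at this
  have hfin : ∀ (s : Finset ℕ) (u : τ.L2), ∑ n ∈ s, ‖W n u‖ ^ 2 ≤ ‖u‖ ^ 2 := fun s u =>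
    τ.dense_hat.induction_on (p := fun u => ∑ n ∈ s, ‖W n u‖ ^ 2 ≤ ‖u‖ ^ 2) u
      (isClosed_le (by fun_prop) (by fun_prop))
      fun x => sum_le_hasSum s (fun n _ => by positivity) (hsum x)
  -- The sum of ‖W_n u‖² is at most ‖u‖², with equality at u = x̂, and subtracting v does not change
  -- any W_n u. Letting x̂ tend to v forces v = 0.
  have hle : ∀ x, ‖τ.hat x‖ ≤ ‖τ.hat x - v‖ := fun x => by
    rw [← sq_le_sq₀ (norm_nonneg _) (norm_nonneg _)]
    refine hasSum_le_of_sum_le (hsum x) fun s => ?_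
    refine (Finset.sum_congr rfl fun n _ => ?_).trans_le (hfin s (τ.hat x - v))
    rw [map_sub, hv _ (hWI n), sub_zero]
  refine norm_le_zero_iff.1 (le_of_forall_pos_lt_add fun ε hε => ?_)
  obtain ⟨x, hx⟩ := τ.dense_hat.exists_dist_lt v (half_pos hε)
  rw [dist_comm, dist_eq_norm] at hx
  calc ‖v‖ = ‖τ.hat x - (τ.hat x - v)‖ := by rw [sub_sub_cancel]
    _ ≤ ‖τ.hat x‖ + ‖τ.hat x - v‖ := norm_sub_le _ _
    _ < 0 + ε := by linarith [hle x]

theorem mem_stdImage_self {y : τ.L2 →L[ℂ] τ.L2} : y ∈ τ.stdImage M ↔ ∃ a, τ.stdRep a = y := by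
  constructor
  · intro hy
    refine exists_eq_of_mem_vnGenerated M τ.stdRep τ.stdRep_injective
      τ.eq_zero_of_forall_intertwiners (vnGenerated_le ?_ hy)
    rintro _ ⟨a, -, rfl⟩
    exact subset_vnGenerated ⟨a, rfl⟩
  · rintro ⟨a, rfl⟩
    exact subset_vnGenerated ⟨a, a.2, rfl⟩

theorem stdRep_mem_stdImage (a : M.Elt) : τ.stdRep a ∈ τ.stdImage M :=
  τ.mem_stdImage_self.2 ⟨a, rfl⟩

theorem isTraceVector_vac : IsTraceVector (τ.stdImage M) τ.vac := by
  constructor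
  · refine τ.dense_hat.mono ?_
    rintro _ ⟨a, rfl⟩
    exact ⟨_, τ.stdRep_mem_stdImage a, τ.stdRep_vac a⟩
  · intro x hx y hy
    obtain ⟨x, rfl⟩ := τ.mem_stdImage_self.1 hx
    obtain ⟨y, rfl⟩ := τ.mem_stdImage_self.1 hy
    rw [stdRep_vac, stdRep_vac, stdRep_hat, stdRep_hat, vac, inner_hat, inner_hat, star_one,
      one_mul, one_mul, τ.tracial]

/-- Normality of the standard representation. -/
theorem stdRep_mem_vnGenerated {S : Set M.Elt} {b : M.Elt}
    (hb : (b : H →L[ℂ] H) ∈ vnGenerated (Subtype.val '' S)) :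
    τ.stdRep b ∈ vnGenerated (τ.stdRep '' S) := by
  -- Adjoints of intertwiners map H into L²(M, τ) and are jointly total because the intertwiners
  -- separate points.
  refine JointlyTotal.mem_vnGenerated
    (I := {j | ∃ W ∈ intertwiners M τ.stdRep, j = ContinuousLinearMap.adjoint W}) ?_ ?_ hb ?_
  · intro v hv
    refine τ.eq_zero_of_forall_intertwiners v fun W hW => ?_
    refine ext_inner_left ℂ fun w => ?_
    rw [inner_zero_right, ← ContinuousLinearMap.adjoint_inner_left]
    exact hv _ ⟨W, hW, rfl⟩ w
  · rintro _ ⟨s, hs, rfl⟩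
    refine ⟨_, ⟨s, hs, rfl⟩, ?_⟩
    rintro _ ⟨W, hW, rfl⟩
    exact (intertwines_of_mem_intertwiners hW s).adjoint
  · rintro _ ⟨W, hW, rfl⟩
    exact (intertwines_of_mem_intertwiners hW b).adjoint

/-- The operator is x̂ ↦ (xb)^, bounded by traciality; it supplies the right bounded vectors from
which the trace on tensor and crossed products is built. -/
theorem exists_rightMul (b : M.Elt) :
    ∃ R ∈ (τ.stdImage M).commutant, R τ.vac = τ.hat b ∧ star R τ.vac = τ.hat (star b) := by
  let f : M.Elt →ₗ[ℂ] τ.L2 :=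
    { toFun := fun x => τ.hat (x * b)
      map_add' := fun x y => by rw [add_mul, hat_add]
      map_smul' := fun c x => by rw [smul_mul_assoc, hat_smul]; rfl }
  let e : M.Elt →ₗ[ℂ] τ.L2 :=
    { toFun := τ.hat
      map_add' := τ.hat_add
      map_smul' := τ.hat_smul }
  have hbound : ∀ x, ‖f x‖ ≤ ‖τ.stdRep (star b)‖ * ‖e x‖ := fun x => by
    have h := τ.isTraceVector_vac.norm_apply_star_apply_le (τ.stdRep_mem_stdImage (star b))
      (τ.stdRep_mem_stdImage x)
    rw [← map_star, star_star, stdRep_vac, stdRep_vac, stdRep_hat] at h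
    exact h
  have hR : ∀ x : M.Elt, f.extendOfNorm e (τ.hat x) = τ.hat (x * b) := fun x =>
    LinearMap.extendOfNorm_eq (f := f) (e := e) τ.dense_hat ⟨_, hbound⟩ x
  refine ⟨f.extendOfNorm e, ?_, by rw [vac, hR, one_mul], ?_⟩
  · rw [VonNeumannAlgebra.mem_commutant_iff]
    intro g hg
    obtain ⟨a, rfl⟩ := τ.mem_stdImage_self.1 hg
    refine τ.ext_hat fun x => ?_
    rw [mul_apply_eq_comp, mul_apply_eq_comp, hR, stdRep_hat, stdRep_hat, hR, mul_assoc]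
  · refine sub_eq_zero.1 (τ.isTraceVector_vac.eq_zero_of_inner fun y hy => ?_)
    obtain ⟨y, rfl⟩ := τ.mem_stdImage_self.1 hy
    rw [stdRep_vac, inner_sub_right, inner_star_right, hR, vac, inner_hat, inner_hat, mul_one,
      star_mul, τ.tracial, sub_self]

end FaithfulNormalTrace

/-! ### Unitary implementation of the actions -/

namespace TraceAction

variable {Γ : Type w} [Group Γ] {H : Type u} [NormedAddCommGroup H]
  [InnerProductSpace ℂ H] [CompleteSpace H] {M : VonNeumannAlgebra H}
  {τ : FaithfulNormalTrace M} (σ : TraceAction Γ τ)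

theorem koopman_hat (g : Γ) (x : M.Elt) :
    (σ.koopman g : τ.L2 →L[ℂ] τ.L2) (τ.hat x) = τ.hat (σ.aut g x) :=
  σ.koopmanOp_coe g x

theorem koopman_vac (g : Γ) : (σ.koopman g : τ.L2 →L[ℂ] τ.L2) τ.vac = τ.vac := by
  rw [FaithfulNormalTrace.vac, koopman_hat, map_one]

theorem koopman_mul_stdRep (g : Γ) (x : M.Elt) :
    (σ.koopman g : τ.L2 →L[ℂ] τ.L2) * τ.stdRep x =
      τ.stdRep (σ.aut g x) * (σ.koopman g : τ.L2 →L[ℂ] τ.L2) :=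
  τ.ext_hat fun y => by
    rw [mul_apply_eq_comp, mul_apply_eq_comp, τ.stdRep_hat, koopman_hat, koopman_hat,
      τ.stdRep_hat, map_mul]

end TraceAction

/-! ### Hilbert space tensor products and slices -/

section Tensor

variable {L₁ : Type u} {L₂ : Type v} [NormedAddCommGroup L₁] [InnerProductSpace ℂ L₁]
  [NormedAddCommGroup L₂] [InnerProductSpace ℂ L₂]

/-- The elementary tensor `v ⊗ w` in the Hilbert space tensor product. -/
def pureTensor (v : L₁) (w : L₂) : HilbertTensor L₁ L₂ := ((v ⊗ₜ[ℂ] w : L₁ ⊗[ℂ] L₂) : _)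

theorem opTensor_pureTensor (a : L₁ →L[ℂ] L₁) (b : L₂ →L[ℂ] L₂) (v : L₁) (w : L₂) :
    opTensor a b (pureTensor v w) = pureTensor (a v) (b w) := by
  rw [pureTensor, opTensor_coe, TensorProduct.mapL_tmul]; rfl

theorem inner_pureTensor (v v' : L₁) (w w' : L₂) :
    inner ℂ (pureTensor v w) (pureTensor v' w') = inner ℂ v v' * inner ℂ w w' := by
  rw [pureTensor, pureTensor, UniformSpace.Completion.inner_coe, TensorProduct.inner_tmul]

/-- `v ↦ v ⊗ w` -/
def tensorRight (w : L₂) : L₁ →L[ℂ] HilbertTensor L₁ L₂ :=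
  UniformSpace.Completion.toComplL ∘L (TensorProduct.mkL ℂ L₁ L₂).flip w

/-- `w ↦ v ⊗ w` -/
def tensorLeft (v : L₁) : L₂ →L[ℂ] HilbertTensor L₁ L₂ :=
  UniformSpace.Completion.toComplL ∘L TensorProduct.mkL ℂ L₁ L₂ v

theorem tensorRight_apply (v : L₁) (w : L₂) : tensorRight w v = pureTensor v w := rfl

theorem tensorLeft_apply (v : L₁) (w : L₂) : tensorLeft v w = pureTensor v w := rfl

theorem continuous_pureTensor : Continuous fun p : L₁ × L₂ => pureTensor p.1 p.2 :=
  (UniformSpace.Completion.continuous_coe _).comp TensorProduct.continuous_tmul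

theorem mem_of_pureTensor_mem {D : Submodule ℂ (HilbertTensor L₁ L₂)}
    (hD : IsClosed (D : Set (HilbertTensor L₁ L₂)))
    (h : ∀ (v : L₁) (w : L₂), pureTensor v w ∈ D) (x : HilbertTensor L₁ L₂) : x ∈ D := by
  induction x using UniformSpace.Completion.induction_on with
  | hp => exact hD
  | ih x =>
    induction x with
    | zero => exact D.zero_mem
    | add x y hx hy => rw [UniformSpace.Completion.coe_add]; exact D.add_mem hx hy
    | tmul v w => exact h v w

theorem eq_zero_of_inner_pureTensor {x : HilbertTensor L₁ L₂}
    (h : ∀ (v : L₁) (w : L₂), inner ℂ (pureTensor v w) x = 0) : x = 0 := by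
  have h1 := mem_of_pureTensor_mem (D := (Submodule.span ℂ {x})ᗮ)
    (Submodule.isClosed_orthogonal _)
    (fun v w => by
      rw [Submodule.mem_orthogonal_singleton_iff_inner_left]
      exact h v w) x
  rw [Submodule.mem_orthogonal_singleton_iff_inner_left] at h1
  exact inner_self_eq_zero.1 h1

theorem jointlyTotal_tensorRight :
    JointlyTotal (Set.range (tensorRight : L₂ → L₁ →L[ℂ] HilbertTensor L₁ L₂)) := fun _ h =>
  eq_zero_of_inner_pureTensor fun v w => h _ ⟨w, rfl⟩ v

theorem jointlyTotal_tensorLeft :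
    JointlyTotal (Set.range (tensorLeft : L₁ → L₂ →L[ℂ] HilbertTensor L₁ L₂)) := fun _ h =>
  eq_zero_of_inner_pureTensor fun v w => h _ ⟨v, rfl⟩ w

theorem opTensor_eq_mul (a : L₁ →L[ℂ] L₁) (b : L₂ →L[ℂ] L₂) :
    opTensor a b = opTensor a 1 * opTensor 1 b := by
  rw [← opTensor_mul, mul_one, one_mul]

variable [CompleteSpace L₁] [CompleteSpace L₂]

theorem intertwines_tensorRight (a : L₁ →L[ℂ] L₁) (w : L₂) :
    Intertwines (tensorRight w) a (opTensor a 1) := by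
  constructor
  · intro v
    rw [tensorRight_apply, tensorRight_apply, opTensor_pureTensor]; rfl
  · intro v
    rw [star_opTensor, star_one, tensorRight_apply, tensorRight_apply, opTensor_pureTensor]; rfl

theorem intertwines_tensorLeft (b : L₂ →L[ℂ] L₂) (v : L₁) :
    Intertwines (tensorLeft v) b (opTensor 1 b) := by
  constructor
  · intro w
    rw [tensorLeft_apply, tensorLeft_apply, opTensor_pureTensor]; rfl
  · intro w
    rw [star_opTensor, star_one, tensorLeft_apply, tensorLeft_apply, opTensor_pureTensor]; rfl

variable {A : VonNeumannAlgebra L₁} {B : VonNeumannAlgebra L₂}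

theorem opTensor_mem_vnTensor {a : L₁ →L[ℂ] L₁} {b : L₂ →L[ℂ] L₂} (ha : a ∈ A) (hb : b ∈ B) :
    opTensor a b ∈ vnTensor A B :=
  subset_vnGenerated ⟨a, ha, b, hb, rfl⟩

theorem opTensor_mem_commutant {a : L₁ →L[ℂ] L₁} {b : L₂ →L[ℂ] L₂} (ha : a ∈ A.commutant)
    (hb : b ∈ B.commutant) : opTensor a b ∈ (vnTensor A B).commutant := by
  rw [VonNeumannAlgebra.mem_commutant_iff] at ha hb
  refine mem_commutant_vnGenerated ?_
  rintro _ ⟨c, hc, d, hd, rfl⟩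
  rw [star_opTensor, ← opTensor_mul, ← opTensor_mul, ← opTensor_mul, ← opTensor_mul, ha c hc,
    hb d hd, ha _ (star_mem hc), hb _ (star_mem hd)]
  exact ⟨rfl, rfl⟩

theorem opTensor_mem_rightBounded {Ω₁ : L₁} {Ω₂ : L₂} {a : L₁ →L[ℂ] L₁} {b : L₂ →L[ℂ] L₂}
    (ha : a ∈ rightBounded A Ω₁) (hb : b ∈ rightBounded B Ω₂) :
    opTensor a b ∈ rightBounded (vnTensor A B) (pureTensor Ω₁ Ω₂) := by
  obtain ⟨ha, R, hR, h1, h2⟩ := ha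
  obtain ⟨hb, R', hR', h1', h2'⟩ := hb
  refine ⟨opTensor_mem_vnTensor ha hb, opTensor R R', opTensor_mem_commutant hR hR', ?_, ?_⟩
  · rw [opTensor_pureTensor, opTensor_pureTensor, h1, h1']
  · rw [star_opTensor, star_opTensor, opTensor_pureTensor, opTensor_pureTensor, h2, h2']

/-- The slices `(1 ⊗ w)* x (1 ⊗ w')` of `x ∈ A ⊗̄ B` lie in `A`. -/
theorem slice_mem {x : HilbertTensor L₁ L₂ →L[ℂ] HilbertTensor L₁ L₂} (hx : x ∈ vnTensor A B)
    (w w' : L₂) : ContinuousLinearMap.adjoint (tensorRight w) ∘L x ∘L tensorRight w' ∈ A := by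
  refine A.mem_of_commutes fun T hT => ?_
  ext v
  have h := opTensor_mem_commutant hT (one_mem B.commutant)
  simp only [mul_apply_eq_comp, ContinuousLinearMap.comp_apply]
  rw [(intertwines_tensorRight T w').1, (vnTensor A B).commutes hx h,
    (intertwines_tensorRight T w).adjoint.1]

/-- The slices `(v ⊗ 1)* x (v' ⊗ 1)` of `x ∈ A ⊗̄ B` lie in `B`. -/
theorem slice_mem' {x : HilbertTensor L₁ L₂ →L[ℂ] HilbertTensor L₁ L₂} (hx : x ∈ vnTensor A B)
    (v v' : L₁) : ContinuousLinearMap.adjoint (tensorLeft v) ∘L x ∘L tensorLeft v' ∈ B := by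
  refine B.mem_of_commutes fun T hT => ?_
  ext w
  have h := opTensor_mem_commutant (one_mem A.commutant) hT
  simp only [mul_apply_eq_comp, ContinuousLinearMap.comp_apply]
  rw [(intertwines_tensorLeft T v').1, (vnTensor A B).commutes hx h,
    (intertwines_tensorLeft T v).adjoint.1]

end Tensor

/-! ### Right bounded vectors of the tensor product -/

section StandardTensor

variable {H : Type u} [NormedAddCommGroup H] [InnerProductSpace ℂ H] [CompleteSpace H]
  {K : Type v} [NormedAddCommGroup K] [InnerProductSpace ℂ K] [CompleteSpace K]
  {P : VonNeumannAlgebra H} {Q : VonNeumannAlgebra K}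

theorem FaithfulNormalTrace.stdRep_mem_rightBounded (τ : FaithfulNormalTrace P) (a : P.Elt) :
    τ.stdRep a ∈ rightBounded (τ.stdImage P) τ.vac := by
  obtain ⟨R, hR, h1, h2⟩ := τ.exists_rightMul a
  refine ⟨τ.stdRep_mem_stdImage a, R, hR, ?_, ?_⟩
  · rw [h1, τ.stdRep_vac]
  · rw [h2, ← map_star, τ.stdRep_vac]

variable (τP : FaithfulNormalTrace P) (τQ : FaithfulNormalTrace Q)

theorem mem_rightBoundedClosure_vnTensor (x : HilbertTensor τP.L2 τQ.L2) :
    x ∈ rightBoundedClosure (vnTensor (τP.stdImage P) (τQ.stdImage Q))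
      (pureTensor τP.vac τQ.vac) := by
  refine mem_of_pureTensor_mem isClosed_rightBoundedClosure (fun v w => ?_) x
  refine (τP.dense_hat.prodMap τQ.dense_hat).induction_on (p := fun p : τP.L2 × τQ.L2 =>
    pureTensor p.1 p.2 ∈ rightBoundedClosure (vnTensor (τP.stdImage P) (τQ.stdImage Q))
      (pureTensor τP.vac τQ.vac)) (v, w)
    (isClosed_rightBoundedClosure.preimage continuous_pureTensor) fun p => ?_
  have := apply_mem_rightBoundedClosure (opTensor_mem_rightBounded
    (τP.stdRep_mem_rightBounded p.1) (τQ.stdRep_mem_rightBounded p.2))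
  rwa [opTensor_pureTensor, τP.stdRep_vac, τQ.stdRep_vac] at this

end StandardTensor

/-! ### Coordinates and diagonal operators on ℓ²(Γ, L) -/

section Fibers

variable {Γ : Type w} {L : Type u} [NormedAddCommGroup L] [InnerProductSpace ℂ L]

open Classical in
/-- The inclusion `v ↦ δ_s ⊗ v` of `L` into `ℓ²(Γ, L)`. -/
def fiber (s : Γ) : L →L[ℂ] L2Group Γ L :=
  lp.singleContinuousLinearMap ℂ (fun _ : Γ => L) 2 s

theorem fiber_apply_self (s : Γ) (v : L) : fiber s v s = v := by
  classical
  exact lp.single_apply_self _ _ _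

theorem fiber_apply_of_ne {s t : Γ} (h : t ≠ s) (v : L) : fiber s v t = 0 := by
  classical
  exact lp.single_apply_ne _ _ _ h

theorem inner_fiber (s : Γ) (v : L) (f : L2Group Γ L) : inner ℂ (fiber s v) f = inner ℂ v (f s) := by
  classical
  exact lp.inner_single_left (𝕜 := ℂ) (G := fun _ => L) s v f

theorem adjoint_fiber [CompleteSpace L] (s : Γ) (f : L2Group Γ L) :
    ContinuousLinearMap.adjoint (fiber s) f = f s :=
  ext_inner_left ℂ fun v => by rw [ContinuousLinearMap.adjoint_inner_right, inner_fiber]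

theorem jointlyTotal_fiber : JointlyTotal (Set.range (fiber : Γ → L →L[ℂ] L2Group Γ L)) := by
  intro f hf
  ext s
  refine ext_inner_left ℂ fun v => ?_
  rw [← inner_fiber, hf _ ⟨s, rfl⟩]
  exact inner_zero_right _ |>.symm

theorem mem_of_fiber_mem {D : Submodule ℂ (L2Group Γ L)} (hD : IsClosed (D : Set (L2Group Γ L)))
    (h : ∀ (s : Γ) (v : L), fiber s v ∈ D) (f : L2Group Γ L) : f ∈ D := by
  classical
  exact hD.mem_of_tendsto (lp.hasSum_single (by norm_num) f)
    (Filter.Eventually.of_forall fun S => D.sum_mem fun s _ => h s (f s))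

theorem summable_weightedPerm {T : Γ → L →L[ℂ] L} {C : ℝ} (hT : ∀ s v, ‖T s v‖ ≤ C * ‖v‖)
    (e : Γ ≃ Γ) (f : L2Group Γ L) :
    Summable (fun s : Γ => ‖T s (f (e s))‖ ^ 2) ∧
      ∑' s : Γ, ‖T s (f (e s))‖ ^ 2 ≤ (C * ‖f‖) ^ 2 := by
  have h0 : HasSum (fun s : Γ => ‖f s‖ ^ 2) (‖f‖ ^ 2) := by
    have h := lp.hasSum_norm (p := 2) (by norm_num) f
    simpa only [ENNReal.toReal_ofNat, Real.rpow_ofNat] using h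
  have h2 := ((Equiv.hasSum_iff (f := fun s : Γ => ‖f s‖ ^ 2) e).2 h0).mul_left (C ^ 2)
  have hle : ∀ s : Γ, ‖T s (f (e s))‖ ^ 2 ≤ C ^ 2 * ‖f (e s)‖ ^ 2 := fun s => by
    rw [← mul_pow]
    exact pow_le_pow_left₀ (norm_nonneg _) (hT s _) 2
  have hs : Summable (fun s : Γ => ‖T s (f (e s))‖ ^ 2) :=
    Summable.of_nonneg_of_le (fun s => by positivity) hle h2.summable
  refine ⟨hs, ?_⟩
  rw [mul_pow]
  exact hasSum_le hle hs.hasSum h2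

/-- The operator `f ↦ (s ↦ T_s f(e(s)))` on `ℓ²(Γ, L)`. -/
def weightedPerm (T : Γ → L →L[ℂ] L) {C : ℝ} (hC : 0 ≤ C) (hT : ∀ s v, ‖T s v‖ ≤ C * ‖v‖)
    (e : Γ ≃ Γ) : L2Group Γ L →L[ℂ] L2Group Γ L :=
  LinearMap.mkContinuous
    { toFun := fun f => ⟨fun s => T s (f (e s)),
        memℓp_gen (by simpa using (summable_weightedPerm hT e f).1)⟩
      map_add' := fun f f' => by ext s; exact map_add (T s) _ _
      map_smul' := fun c f => by ext s; exact map_smul (T s) c _ }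
    C fun f => by
      refine lp.norm_le_of_tsum_le (p := 2) (by norm_num) (by positivity) ?_
      simpa using (summable_weightedPerm hT e f).2

end Fibers

/-! ### Crossed products: commutant, Fourier coefficients, trace vector -/

section Crossed

variable {Γ : Type w} [Group Γ] {L : Type u} [NormedAddCommGroup L] [InnerProductSpace ℂ L]

theorem twistTranslate_fiber (T : L →L[ℂ] L) (g t : Γ) (v : L) :
    twistTranslate T g (fiber t v) = fiber (g * t) (T v) := by
  ext s
  rw [twistTranslate_apply]
  by_cases h : s = g * t
  · subst h
    rw [inv_mul_cancel_left, fiber_apply_self, fiber_apply_self]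
  · rw [fiber_apply_of_ne h, fiber_apply_of_ne fun h' => h (by rw [← h', mul_inv_cancel_left]),
      map_zero]

theorem twistTranslate_mul (T S : L →L[ℂ] L) (g h : Γ) :
    twistTranslate T g * twistTranslate S h = twistTranslate (T * S) (g * h) := by
  ext f s
  rw [mul_apply_eq_comp, twistTranslate_apply, twistTranslate_apply, twistTranslate_apply,
    mul_inv_rev, mul_assoc]
  rfl

/-- Right translation `f ↦ (s ↦ f(s g))`. -/
def rightTranslate (L : Type u) [NormedAddCommGroup L] [InnerProductSpace ℂ L] (g : Γ) :
    L2Group Γ L →L[ℂ] L2Group Γ L :=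
  weightedPerm (fun _ => (1 : L →L[ℂ] L)) zero_le_one
    (fun _ v => (one_mul ‖v‖).ge) (Equiv.mulRight g)

theorem rightTranslate_apply (g : Γ) (f : L2Group Γ L) (s : Γ) :
    rightTranslate L g f s = f (s * g) := rfl

theorem rightTranslate_fiber (g t : Γ) (v : L) :
    rightTranslate L g (fiber t v) = fiber (t * g⁻¹) v := by
  ext s
  rw [rightTranslate_apply]
  by_cases h : s = t * g⁻¹
  · subst h
    rw [inv_mul_cancel_right, fiber_apply_self, fiber_apply_self]
  · rw [fiber_apply_of_ne h, fiber_apply_of_ne fun h' => h (by rw [← h', mul_inv_cancel_right])]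

variable [CompleteSpace L]

theorem star_twistTranslate (T : L →L[ℂ] L) (g : Γ) :
    star (twistTranslate T g) = twistTranslate (star T) g⁻¹ := by
  refine jointlyTotal_fiber.eq ?_
  rintro _ ⟨s, rfl⟩ _ ⟨t, rfl⟩ v w
  rw [inner_star_right, twistTranslate_fiber, twistTranslate_fiber, inner_fiber, inner_fiber]
  by_cases h : s = g⁻¹ * t
  · subst h
    rw [mul_inv_cancel_left, fiber_apply_self, fiber_apply_self, inner_star_right]
  · rw [fiber_apply_of_ne h, fiber_apply_of_ne fun h' => h (by rw [← h', inv_mul_cancel_left]),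
      inner_zero_right, inner_zero_right]

theorem twistTranslate_conj (S T : L →L[ℂ] L) (g : Γ) :
    twistTranslate S g * twistTranslate T 1 * star (twistTranslate S g) =
      twistTranslate (S * T * star S) 1 := by
  rw [star_twistTranslate, twistTranslate_mul, twistTranslate_mul, mul_one, mul_inv_cancel]

theorem intertwines_fiber (a : L →L[ℂ] L) (s : Γ) :
    Intertwines (fiber s) a (twistTranslate a 1) := by
  constructor
  · intro v
    rw [twistTranslate_fiber, one_mul]
  · intro v
    rw [star_twistTranslate, twistTranslate_fiber, inv_one, one_mul]

theorem coe_map_inv_eq_star (U : Γ →* unitary (L →L[ℂ] L)) (g : Γ) :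
    (U g⁻¹ : L →L[ℂ] L) = star (U g : L →L[ℂ] L) := by
  rw [map_inv]; rfl

theorem unitary_star_apply_self (u : unitary (L →L[ℂ] L)) (v : L) :
    star (u : L →L[ℂ] L) ((u : L →L[ℂ] L) v) = v :=
  DFunLike.congr_fun (Unitary.star_mul_self_of_mem u.2) v

theorem unitary_self_apply_star (u : unitary (L →L[ℂ] L)) (v : L) :
    (u : L →L[ℂ] L) (star (u : L →L[ℂ] L) v) = v :=
  DFunLike.congr_fun (Unitary.mul_star_self_of_mem u.2) v

theorem norm_unitary_apply (u : unitary (L →L[ℂ] L)) (v : L) : ‖(u : L →L[ℂ] L) v‖ = ‖v‖ := by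
  rw [@norm_eq_sqrt_re_inner ℂ, @norm_eq_sqrt_re_inner ℂ _ _ _ _ v, ← inner_star_right,
    unitary_star_apply_self]

variable {A : VonNeumannAlgebra L} {U : Γ →* unitary (L →L[ℂ] L)}

theorem twistTranslate_mem_crossedProduct {a : L →L[ℂ] L} (ha : a ∈ A) :
    twistTranslate a 1 ∈ crossedProduct A U :=
  subset_vnGenerated (Or.inl ⟨a, ha, rfl⟩)

theorem canonicalUnitary_mem_crossedProduct (g : Γ) :
    twistTranslate (U g : L →L[ℂ] L) g ∈ crossedProduct A U :=
  subset_vnGenerated (Or.inr ⟨g, rfl⟩)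

theorem crossedProduct_le {N : VonNeumannAlgebra (L2Group Γ L)}
    (hA : ∀ a ∈ A, twistTranslate a 1 ∈ N) (hU : ∀ g, twistTranslate (U g : L →L[ℂ] L) g ∈ N) :
    crossedProduct A U ≤ N := by
  refine vnGenerated_le ?_
  rintro _ (⟨a, ha, rfl⟩ | ⟨g, rfl⟩)
  · exact hA a ha
  · exact hU g

theorem mem_commutant_crossedProduct {T : L2Group Γ L →L[ℂ] L2Group Γ L}
    (hA : ∀ a ∈ A, twistTranslate a 1 * T = T * twistTranslate a 1)
    (hU : ∀ g, twistTranslate (U g : L →L[ℂ] L) g * T = T * twistTranslate (U g : L →L[ℂ] L) g) :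
    T ∈ (crossedProduct A U).commutant := by
  refine mem_commutant_vnGenerated ?_
  rintro _ (⟨a, ha, rfl⟩ | ⟨g, rfl⟩)
  · rw [star_twistTranslate, inv_one]
    exact ⟨hA a ha, hA _ (star_mem ha)⟩
  · rw [star_twistTranslate, ← coe_map_inv_eq_star]
    exact ⟨hU g, hU g⁻¹⟩

/-- The operator `f ↦ (s ↦ U_s T U_s* f(s))`. -/
def covariantDiag (U : Γ →* unitary (L →L[ℂ] L)) (T : L →L[ℂ] L) :
    L2Group Γ L →L[ℂ] L2Group Γ L :=
  weightedPerm (fun s => (U s : L →L[ℂ] L) * T * star (U s : L →L[ℂ] L)) (norm_nonneg T)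
    (fun s v => by
      rw [mul_apply_eq_comp, mul_apply_eq_comp, norm_unitary_apply]
      refine (T.le_opNorm _).trans_eq ?_
      rw [← Unitary.coe_star, norm_unitary_apply]) (Equiv.refl Γ)

theorem covariantDiag_apply (T : L →L[ℂ] L) (f : L2Group Γ L) (s : Γ) :
    covariantDiag U T f s = (U s : L →L[ℂ] L) (T (star (U s : L →L[ℂ] L) (f s))) := rfl

theorem covariantDiag_fiber_one (T : L →L[ℂ] L) (v : L) :
    covariantDiag U T (fiber 1 v) = fiber 1 (T v) := by
  ext s
  rw [covariantDiag_apply]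
  by_cases h : s = 1
  · subst h
    rw [map_one, fiber_apply_self, fiber_apply_self, OneMemClass.coe_one, star_one]; rfl
  · rw [fiber_apply_of_ne h, fiber_apply_of_ne h, map_zero, map_zero, map_zero]

theorem star_covariantDiag (T : L →L[ℂ] L) :
    star (covariantDiag U T) = covariantDiag U (star T) := by
  refine jointlyTotal_fiber.eq ?_
  rintro _ ⟨s, rfl⟩ _ ⟨t, rfl⟩ v w
  rw [inner_star_right, inner_fiber, covariantDiag_apply, ← inner_conj_symm, inner_fiber,
    inner_conj_symm, covariantDiag_apply]
  by_cases h : s = t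
  · subst h
    rw [fiber_apply_self, fiber_apply_self, ← inner_star_right, ← inner_star_right,
      ← inner_star_right, star_star]
  · rw [fiber_apply_of_ne h, fiber_apply_of_ne (Ne.symm h)]
    simp

theorem star_rightTranslate (g : Γ) : star (rightTranslate L g) = rightTranslate L g⁻¹ := by
  refine jointlyTotal_fiber.eq ?_
  rintro _ ⟨s, rfl⟩ _ ⟨t, rfl⟩ v w
  rw [inner_star_right, rightTranslate_fiber, inner_fiber, inner_fiber, rightTranslate_apply]

theorem rightTranslate_mem_commutant (g : Γ) :
    rightTranslate L g ∈ (crossedProduct A U).commutant := by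
  refine mem_commutant_crossedProduct (fun a _ => ?_) fun h => ?_
  · ext f s
    simp only [mul_apply_eq_comp, rightTranslate_apply, twistTranslate_apply, mul_assoc]
  · ext f s
    simp only [mul_apply_eq_comp, rightTranslate_apply, twistTranslate_apply, mul_assoc]

theorem conj_mem_commutant
    (hA : ∀ g, ∀ a ∈ A, (U g : L →L[ℂ] L) * a * star (U g : L →L[ℂ] L) ∈ A)
    (g : Γ) {T : L →L[ℂ] L} (hT : T ∈ A.commutant) :
    (U g : L →L[ℂ] L) * T * star (U g : L →L[ℂ] L) ∈ A.commutant := by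
  rw [VonNeumannAlgebra.mem_commutant_iff]
  intro a ha
  have h := hA g⁻¹ a ha
  rw [coe_map_inv_eq_star, star_star] at h
  ext v
  have h1 := A.commutes h hT (star (U g : L →L[ℂ] L) v)
  simp only [mul_apply_eq_comp, unitary_self_apply_star] at h1 ⊢
  rw [← h1, unitary_self_apply_star]

/-- Each entry U_s T U_s* stays in A', and this dependence on s is exactly what makes the diagonal
operator commute with U_g ⊗ λ_g. -/
theorem covariantDiag_mem_commutant
    (hA : ∀ g, ∀ a ∈ A, (U g : L →L[ℂ] L) * a * star (U g : L →L[ℂ] L) ∈ A)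
    {T : L →L[ℂ] L} (hT : T ∈ A.commutant) :
    covariantDiag U T ∈ (crossedProduct A U).commutant := by
  refine mem_commutant_crossedProduct (fun a ha => ?_) fun g => ?_
  · ext f s
    have h := A.commutes ha (conj_mem_commutant hA s hT) (f s)
    simp only [mul_apply_eq_comp, covariantDiag_apply, twistTranslate_apply, inv_one, one_mul]
      at h ⊢
    exact h
  · ext f s
    have h : (U (g⁻¹ * s) : L →L[ℂ] L) = star (U g : L →L[ℂ] L) * (U s : L →L[ℂ] L) := by
      rw [map_mul, Submonoid.coe_mul, coe_map_inv_eq_star]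
    simp only [mul_apply_eq_comp, covariantDiag_apply, twistTranslate_apply, h, star_mul,
      star_star, unitary_self_apply_star]

/-- The Fourier coefficient of `x` at `s`. -/
def coefficient (U : Γ →* unitary (L →L[ℂ] L)) (x : L2Group Γ L →L[ℂ] L2Group Γ L) (s : Γ) :
    L →L[ℂ] L :=
  star (U s : L →L[ℂ] L) ∘L ContinuousLinearMap.adjoint (fiber s) ∘L x ∘L fiber 1

/-- With this normalisation x is formally the sum of u_s b_s, coefficients on the right. -/
theorem apply_fiber_one (x : L2Group Γ L →L[ℂ] L2Group Γ L) (s : Γ) (v : L) :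
    x (fiber 1 v) s = (U s : L →L[ℂ] L) (coefficient U x s v) := by
  simp only [coefficient, ContinuousLinearMap.comp_apply, adjoint_fiber, unitary_self_apply_star]

/-- For T ∈ A' the covariant diagonal operator commutes with x. At coordinate s of x(δ_1 ⊗ v) its
factors U_s cancel, leaving b_s T = T b_s. -/
theorem coefficient_mem
    (hA : ∀ g, ∀ a ∈ A, (U g : L →L[ℂ] L) * a * star (U g : L →L[ℂ] L) ∈ A)
    {x : L2Group Γ L →L[ℂ] L2Group Γ L} (hx : x ∈ crossedProduct A U) (s : Γ) :
    coefficient U x s ∈ A := by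
  refine A.mem_of_commutes fun T hT => ?_
  ext v
  have h := VonNeumannAlgebra.commutes _ hx (covariantDiag_mem_commutant hA hT) (fiber 1 v)
  rw [covariantDiag_fiber_one] at h
  simp only [coefficient, mul_apply_eq_comp, ContinuousLinearMap.comp_apply, adjoint_fiber]
  rw [h, covariantDiag_apply, unitary_star_apply_self]

theorem coefficient_commutes {x : L2Group Γ L →L[ℂ] L2Group Γ L} {a : L →L[ℂ] L}
    (h : twistTranslate a 1 * x = x * twistTranslate a 1) (s : Γ) :
    star (U s : L →L[ℂ] L) * a * (U s : L →L[ℂ] L) * coefficient U x s =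
      coefficient U x s * a := by
  ext v
  have h2 := congrArg (fun f => f s) (DFunLike.congr_fun h (fiber 1 v))
  simp only [mul_apply_eq_comp, twistTranslate_fiber, twistTranslate_apply, inv_one,
    one_mul, apply_fiber_one (U := U)] at h2 ⊢
  rw [h2, unitary_star_apply_self]

/-- Both operators lie in the crossed product and agree on its trace vector, which is separating. -/
theorem eq_twistTranslate_of_coefficient {Ω : L}
    (hT : IsTraceVector (crossedProduct A U) (fiber 1 Ω))
    {x : L2Group Γ L →L[ℂ] L2Group Γ L} (hx : x ∈ crossedProduct A U)
    (h0 : ∀ s, s ≠ 1 → coefficient U x s = 0) (h1 : coefficient U x 1 ∈ A) :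
    x = twistTranslate (coefficient U x 1) 1 := by
  refine sub_eq_zero.1 <| hT.eq_zero_of_apply_eq_zero
    (sub_mem hx (twistTranslate_mem_crossedProduct h1)) ?_
  rw [sub_apply, sub_eq_zero, twistTranslate_fiber, one_mul]
  ext s
  rw [apply_fiber_one (U := U)]
  by_cases h : s = 1
  · subst h
    rw [map_one, fiber_apply_self]; rfl
  · rw [h0 s h, fiber_apply_of_ne h, zero_apply, map_zero]

variable {Ω : L}

theorem twistTranslate_mem_rightBounded
    (hA : ∀ g, ∀ a ∈ A, (U g : L →L[ℂ] L) * a * star (U g : L →L[ℂ] L) ∈ A)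
    {a : L →L[ℂ] L} (ha : a ∈ rightBounded A Ω) :
    twistTranslate a 1 ∈ rightBounded (crossedProduct A U) (fiber 1 Ω) := by
  obtain ⟨ha, R, hR, h1, h2⟩ := ha
  refine ⟨twistTranslate_mem_crossedProduct ha, covariantDiag U R,
    covariantDiag_mem_commutant hA hR, ?_, ?_⟩
  · rw [covariantDiag_fiber_one, twistTranslate_fiber, h1, one_mul]
  · rw [star_covariantDiag, star_twistTranslate, covariantDiag_fiber_one, twistTranslate_fiber, h2,
      inv_one, one_mul]

/-- As U_g fixes Ω, the canonical unitary acts on δ_1 ⊗ Ω as a mere translation, which a right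
translation in the commutant reproduces. -/
theorem canonicalUnitary_mem_rightBounded (hΩ : ∀ g, (U g : L →L[ℂ] L) Ω = Ω) (g : Γ) :
    twistTranslate (U g : L →L[ℂ] L) g ∈ rightBounded (crossedProduct A U) (fiber 1 Ω) := by
  refine ⟨canonicalUnitary_mem_crossedProduct g, rightTranslate L g⁻¹,
    rightTranslate_mem_commutant _, ?_, ?_⟩
  · rw [rightTranslate_fiber, twistTranslate_fiber, hΩ, one_mul, inv_inv, mul_one]
  · rw [star_rightTranslate, star_twistTranslate, rightTranslate_fiber, twistTranslate_fiber,
      ← coe_map_inv_eq_star, hΩ, inv_inv, one_mul, mul_one]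

theorem isTraceVector_crossedProduct
    (hA : ∀ g, ∀ a ∈ A, (U g : L →L[ℂ] L) * a * star (U g : L →L[ℂ] L) ∈ A)
    (hΩ : ∀ g, (U g : L →L[ℂ] L) Ω = Ω) (hd : ∀ v, v ∈ rightBoundedClosure A Ω) :
    IsTraceVector (crossedProduct A U) (fiber 1 Ω) := by
  refine isTraceVector_of_rightBoundedClosure
    (mem_of_fiber_mem isClosed_rightBoundedClosure fun s v => ?_)
  refine map_mem_closure (fiber s).continuous (hd v) ?_
  rintro _ ⟨d, hd, rfl⟩
  refine ⟨_, (rightBounded _ _).mul_mem (twistTranslate_mem_rightBounded hA hd)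
    (canonicalUnitary_mem_rightBounded hΩ s), ?_⟩
  change twistTranslate d 1 (twistTranslate (U s : L →L[ℂ] L) s (fiber 1 Ω)) = fiber s (d Ω)
  rw [twistTranslate_fiber, twistTranslate_fiber, hΩ, one_mul, mul_one]

end Crossed

/-! ### Bimodularity of expectations; conjugation by unitaries -/

section Expectation

variable {H : Type u} [NormedAddCommGroup H] [InnerProductSpace ℂ H] [CompleteSpace H]
  {M N : VonNeumannAlgebra H} {Ω : H}

/-- Bimodularity in weak form: for k ∈ N, testing n against p*k and k p* shows that pnΩ and npΩ have
the inner products with kΩ that pxΩ and xpΩ have, and px = xp. -/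
theorem IsTraceVector.expectation_commutes (h : IsTraceVector M Ω) (hN : N ≤ M)
    {x n p : H →L[ℂ] H} (hx : x ∈ M) (hn : n ∈ N)
    (hnx : ∀ k ∈ N, inner ℂ (k Ω) (n Ω) = inner ℂ (k Ω) (x Ω)) (hp : p ∈ N)
    (hpx : p * x = x * p) : p * n = n * p := by
  have h1 : ∀ k ∈ N, inner ℂ (k Ω) (p (n Ω)) = inner ℂ (k Ω) (n (p Ω)) := fun k hk => by
    have h2 := hnx (star p * k) (mul_mem (star_mem hp) hk)
    have h3 := hnx (k * star p) (mul_mem hk (star_mem hp))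
    have h4 := DFunLike.congr_fun hpx Ω
    simp only [mul_apply_eq_comp, inner_star_left] at h2 h3 h4
    rw [h.inner_apply_apply (hN hp) (hN hk) (hN hn), h3, h2, h4,
      h.inner_apply_apply (hN hp) (hN hk) hx]
  have hw : p * n - n * p ∈ N := sub_mem (mul_mem hp hn) (mul_mem hn hp)
  refine sub_eq_zero.1 (h.eq_zero_of_apply_eq_zero (hN hw) ?_)
  rw [← inner_self_eq_zero (𝕜 := ℂ)]
  conv_lhs => rw [sub_apply, inner_sub_right]
  exact sub_eq_zero.2 (h1 _ hw)

theorem conj_mem_of_mem_vnGenerated {S : Set (H →L[ℂ] H)} (u : unitary (H →L[ℂ] H))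
    (hS : ∀ s ∈ S, (u : H →L[ℂ] H) * s * star (u : H →L[ℂ] H) ∈ N) {x : H →L[ℂ] H}
    (hx : x ∈ vnGenerated S) : (u : H →L[ℂ] H) * x * star (u : H →L[ℂ] H) ∈ N := by
  have hi : ∀ x : H →L[ℂ] H,
      Intertwines (u : H →L[ℂ] H) x ((u : H →L[ℂ] H) * x * star (u : H →L[ℂ] H)) := fun x => by
    constructor
    · intro v
      simp only [mul_apply_eq_comp, unitary_star_apply_self]
    · intro v
      simp only [star_mul, star_star, mul_apply_eq_comp, unitary_star_apply_self]
  refine vnGenerated_le (M := N)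
    (S := (fun s => (u : H →L[ℂ] H) * s * star (u : H →L[ℂ] H)) '' S) ?_ ?_
  · rintro _ ⟨s, hs, rfl⟩
    exact hS s hs
  · refine JointlyTotal.mem_vnGenerated (I := {(u : H →L[ℂ] H)}) ?_ ?_ hx ?_
    · intro w hw
      have := hw _ rfl (star (u : H →L[ℂ] H) w)
      rw [unitary_self_apply_star] at this
      exact inner_self_eq_zero.1 this
    · rintro s hs
      refine ⟨_, ⟨s, hs, rfl⟩, ?_⟩
      rintro _ rfl
      exact hi s
    · rintro _ rfl
      exact hi x

end Expectation

/-! ### Amplifications of generated algebras -/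

section Amplification

theorem twistTranslate_mem_of_mem_vnGenerated {Γ : Type w} [Group Γ] {L : Type u}
    [NormedAddCommGroup L] [InnerProductSpace ℂ L] [CompleteSpace L]
    {N : VonNeumannAlgebra (L2Group Γ L)} {S : Set (L →L[ℂ] L)}
    (hS : ∀ s ∈ S, twistTranslate s 1 ∈ N) {d : L →L[ℂ] L} (hd : d ∈ vnGenerated S) :
    twistTranslate d 1 ∈ N := by
  refine vnGenerated_le (M := N) (S := (fun s => twistTranslate s 1) '' S) ?_ ?_
  · rintro _ ⟨s, hs, rfl⟩
    exact hS s hs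
  · refine jointlyTotal_fiber.mem_vnGenerated ?_ hd ?_
    · rintro s hs
      refine ⟨_, ⟨s, hs, rfl⟩, ?_⟩
      rintro _ ⟨t, rfl⟩
      exact intertwines_fiber s t
    · rintro _ ⟨t, rfl⟩
      exact intertwines_fiber d t

theorem opTensor_one_mem_of_mem_vnGenerated {L₁ : Type u} {L₂ : Type v} [NormedAddCommGroup L₁]
    [InnerProductSpace ℂ L₁] [CompleteSpace L₁] [NormedAddCommGroup L₂] [InnerProductSpace ℂ L₂]
    [CompleteSpace L₂] {S : Set (L₂ →L[ℂ] L₂)} {c : L₂ →L[ℂ] L₂} (hc : c ∈ vnGenerated S) :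
    opTensor (1 : L₁ →L[ℂ] L₁) c ∈
      vnGenerated ((fun s => opTensor (1 : L₁ →L[ℂ] L₁) s) '' S) := by
  refine jointlyTotal_tensorLeft.mem_vnGenerated ?_ hc ?_
  · rintro s hs
    refine ⟨_, ⟨s, hs, rfl⟩, ?_⟩
    rintro _ ⟨t, rfl⟩
    exact intertwines_tensorLeft s t
  · rintro _ ⟨t, rfl⟩
    exact intertwines_tensorLeft c t

end Amplification

/-! ### Proper outerness over a factor -/

section Outer

variable {Γ : Type w} [Group Γ] {H : Type u} [NormedAddCommGroup H] [InnerProductSpace ℂ H]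
  [CompleteSpace H] {P : VonNeumannAlgebra H} {τ : FaithfulNormalTrace P}

theorem VonNeumannAlgebra.IsFactor.eq_smul_one (hP : P.IsFactor) {x : P.Elt}
    (h : ∀ a, a * x = x * a) : ∃ c : ℂ, x = c • 1 := by
  obtain ⟨c, hc⟩ := hP x x.2
    (VonNeumannAlgebra.mem_commutant_iff.2 fun a ha => congrArg Subtype.val (h ⟨a, ha⟩))
  exact ⟨c, Subtype.ext hc⟩

/-- Outer automorphisms of a factor are properly outer. -/
theorem TraceAction.IsOuter.eq_zero {σ : TraceAction Γ τ} (hσ : σ.IsOuter) (hP : P.IsFactor)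
    {g : Γ} (hg : g ≠ 1) {y : P.Elt} (h : ∀ a, σ.aut g a * y = y * a) : y = 0 := by
  have hs : ∀ a, star y * σ.aut g a = a * star y := fun a => by
    have := congrArg star (h (star a))
    rwa [star_mul, star_mul, star_star, ← map_star, star_star] at this
  -- The relation for y and its adjoint make y*y and yy* central, hence scalar; the trace shows that
  -- the two scalars coincide.
  obtain ⟨c, hc⟩ := hP.eq_smul_one (x := star y * y) fun a => by
    rw [← mul_assoc, ← hs, mul_assoc, h, mul_assoc]
  obtain ⟨c', hc'⟩ := hP.eq_smul_one (x := y * star y) fun a => by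
    obtain ⟨a, rfl⟩ : ∃ a', σ.aut g a' = a := (σ.aut g).surjective a
    rw [← mul_assoc, h, mul_assoc, ← hs, mul_assoc]
  have hcc : c' = c := by
    have h1 := τ.tracial y (star y)
    rw [hc, hc', map_smul, map_smul, τ.map_one] at h1
    simpa using h1
  subst hcc
  by_contra hy
  have hc1 : c' = τ.tr (star y * y) := by rw [hc, map_smul, τ.map_one, smul_eq_mul, mul_one]
  have hr : c' = ((‖τ.toPreL2 y‖ ^ 2 : ℝ) : ℂ) := by
    rw [τ.preL2_norm_sq, hc1]
    exact Complex.ext rfl (τ.tr_star_mul_self_im y)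
  have hy0 : τ.toPreL2 y ≠ 0 := fun h0 => hy (τ.toPreL2.map_eq_zero_iff.1 h0)
  set r : ℝ := ‖τ.toPreL2 y‖ with hrdef
  have hrpos : 0 < r := norm_pos_iff.2 hy0
  have hrr : ((r : ℂ)⁻¹ * (r : ℂ)⁻¹) * c' = 1 := by
    rw [hr]
    push_cast
    have : (r : ℂ) ≠ 0 := by exact_mod_cast hrpos.ne'
    field_simp
  have hstar : star ((r : ℂ)⁻¹ • y) = (r : ℂ)⁻¹ • star y := by
    rw [star_smul, star_inv₀, Complex.star_def, Complex.conj_ofReal]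
  -- The common scalar is r² with r the L²-norm of y, so y/r is a unitary implementing σ_g, against
  -- outerness.
  refine hσ g hg ⟨(r : ℂ)⁻¹ • y, ?_, fun a => ?_⟩
  · rw [Unitary.mem_iff, hstar, smul_mul_smul_comm, smul_mul_smul_comm, hc, hc', smul_smul, hrr,
      one_smul]
    exact ⟨rfl, rfl⟩
  · rw [hstar, smul_mul_assoc, ← h, smul_mul_smul_comm, mul_assoc, hc', mul_smul_comm, smul_smul,
      hrr, one_smul, mul_one]

end Outer

/-! ### The relative commutant of P in the crossed product -/

section RelativeCommutant

variable {Γ : Type w} [Group Γ]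
  {H : Type u} [NormedAddCommGroup H] [InnerProductSpace ℂ H] [CompleteSpace H]
  {K : Type v} [NormedAddCommGroup K] [InnerProductSpace ℂ K] [CompleteSpace K]
  {P : VonNeumannAlgebra H} {τP : FaithfulNormalTrace P}
  {Q : VonNeumannAlgebra K} {τQ : FaithfulNormalTrace Q}

theorem slice_intertwines {T S : τP.L2 →L[ℂ] τP.L2}
    {b : HilbertTensor τP.L2 τQ.L2 →L[ℂ] HilbertTensor τP.L2 τQ.L2}
    (h : opTensor T 1 * b = b * opTensor S 1) (w w' : τQ.L2) :
    T * (ContinuousLinearMap.adjoint (tensorRight w) ∘L b ∘L tensorRight w') =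
      (ContinuousLinearMap.adjoint (tensorRight w) ∘L b ∘L tensorRight w') * S := by
  ext v
  have h1 := DFunLike.congr_fun h (tensorRight w' v)
  simp only [mul_apply_eq_comp, ContinuousLinearMap.comp_apply] at h1 ⊢
  rw [← (intertwines_tensorRight T w).adjoint.1, h1, (intertwines_tensorRight S w').1]

/-- Each slice of b over L²(Q) lies in P and satisfies the same twisted relation, so it vanishes by
proper outerness. -/
theorem eq_zero_of_twisted_commutes {σ : TraceAction Γ τP} (hσ : σ.IsOuter) (hP : P.IsFactor)
    {g : Γ} (hg : g ≠ 1) {b : HilbertTensor τP.L2 τQ.L2 →L[ℂ] HilbertTensor τP.L2 τQ.L2}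
    (hb : b ∈ vnTensor (τP.stdImage P) (τQ.stdImage Q))
    (h : ∀ a, opTensor (τP.stdRep (σ.aut g a)) 1 * b = b * opTensor (τP.stdRep a) 1) : b = 0 := by
  refine jointlyTotal_tensorRight.eq ?_
  rintro _ ⟨w, rfl⟩ _ ⟨w', rfl⟩ v v'
  obtain ⟨y, hy⟩ := τP.mem_stdImage_self.1 (slice_mem hb w w')
  have hy0 : y = 0 := hσ.eq_zero hP hg fun a => τP.stdRep_injective <| by
    rw [map_mul τP.stdRep, map_mul τP.stdRep, hy, slice_intertwines (h a)]
  rw [hy0, map_zero τP.stdRep] at hy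
  have h1 := DFunLike.congr_fun hy v'
  rw [ContinuousLinearMap.comp_apply, ContinuousLinearMap.comp_apply] at h1
  rw [← ContinuousLinearMap.adjoint_inner_right, ← h1]
  simp

theorem FaithfulNormalTrace.inner_vac_vac : inner ℂ τP.vac τP.vac = 1 := by
  rw [FaithfulNormalTrace.vac, FaithfulNormalTrace.inner_hat, star_one, one_mul, τP.map_one]

/-- The slices of b over L²(Q) are central in P, hence scalars c(w, w'). The slice of b at the
vacuum of P lies in Q and has exactly these matrix entries; it is the required q. -/
theorem exists_eq_one_tensor (hP : P.IsFactor)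
    {b : HilbertTensor τP.L2 τQ.L2 →L[ℂ] HilbertTensor τP.L2 τQ.L2}
    (hb : b ∈ vnTensor (τP.stdImage P) (τQ.stdImage Q))
    (h : ∀ a, opTensor (τP.stdRep a) 1 * b = b * opTensor (τP.stdRep a) 1) :
    ∃ q, b = opTensor 1 (τQ.stdRep q) := by
  obtain ⟨q, hq⟩ := τQ.mem_stdImage_self.1 (slice_mem' hb τP.vac τP.vac)
  refine ⟨q, jointlyTotal_tensorRight.eq ?_⟩
  rintro _ ⟨w, rfl⟩ _ ⟨w', rfl⟩ v v'
  obtain ⟨y, hy⟩ := τP.mem_stdImage_self.1 (slice_mem hb w w')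
  obtain ⟨c, rfl⟩ := hP.eq_smul_one (x := y) fun a => τP.stdRep_injective <| by
    rw [map_mul τP.stdRep, map_mul τP.stdRep, hy, slice_intertwines (h a)]
  rw [map_smul τP.stdRep, map_one τP.stdRep] at hy
  have hc : ∀ v v', inner ℂ (pureTensor v w) (b (pureTensor v' w')) = c * inner ℂ v v' := by
    intro v v'
    have h1 := congrArg (inner ℂ v) (DFunLike.congr_fun hy v')
    rw [ContinuousLinearMap.comp_apply, ContinuousLinearMap.comp_apply,
      ContinuousLinearMap.adjoint_inner_right] at h1
    rw [← tensorRight_apply, ← tensorRight_apply, ← h1, ← inner_smul_right]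
    rfl
  have hqw : inner ℂ w (τQ.stdRep q w') = c := by
    rw [hq, ContinuousLinearMap.comp_apply, ContinuousLinearMap.comp_apply,
      ContinuousLinearMap.adjoint_inner_right, tensorLeft_apply, tensorLeft_apply, hc,
      FaithfulNormalTrace.inner_vac_vac, mul_one]
  rw [tensorRight_apply, tensorRight_apply, hc, opTensor_pureTensor, inner_pureTensor, hqw,
    mul_comm]
  rfl

variable (σ : TraceAction Γ τP) (ρ : TraceAction Γ τQ)

theorem coe_repTensor_koopman (g : Γ) :
    (repTensor σ.koopman ρ.koopman g : HilbertTensor τP.L2 τQ.L2 →L[ℂ] _) =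
      opTensor (σ.koopman g : τP.L2 →L[ℂ] τP.L2) (ρ.koopman g : τQ.L2 →L[ℂ] τQ.L2) := rfl

theorem TraceAction.koopman_conj (g : Γ) (x : P.Elt) :
    (σ.koopman g : τP.L2 →L[ℂ] τP.L2) * τP.stdRep x * star (σ.koopman g : τP.L2 →L[ℂ] τP.L2) =
      τP.stdRep (σ.aut g x) := by
  rw [koopman_mul_stdRep, mul_assoc, Unitary.mul_star_self_of_mem (σ.koopman g).2, mul_one]

theorem repTensor_conj (g : Γ) (a : P.Elt) (b : Q.Elt) :
    (repTensor σ.koopman ρ.koopman g : HilbertTensor τP.L2 τQ.L2 →L[ℂ] _) *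
        opTensor (τP.stdRep a) (τQ.stdRep b) *
        star (repTensor σ.koopman ρ.koopman g : HilbertTensor τP.L2 τQ.L2 →L[ℂ] _) =
      opTensor (τP.stdRep (σ.aut g a)) (τQ.stdRep (ρ.aut g b)) := by
  rw [coe_repTensor_koopman, star_opTensor, ← opTensor_mul, ← opTensor_mul, σ.koopman_conj,
    ρ.koopman_conj]

theorem repTensor_star_conj (g : Γ) (a : P.Elt) :
    star (repTensor σ.koopman ρ.koopman g : HilbertTensor τP.L2 τQ.L2 →L[ℂ] _) *
        opTensor (τP.stdRep a) 1 *
        (repTensor σ.koopman ρ.koopman g : HilbertTensor τP.L2 τQ.L2 →L[ℂ] _) =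
      opTensor (τP.stdRep (σ.aut g⁻¹ a)) 1 := by
  have h := σ.koopman_conj g⁻¹ a
  have e := coe_map_inv_eq_star σ.koopman g
  rw [e, star_star] at h
  rw [coe_repTensor_koopman, star_opTensor, ← opTensor_mul, ← opTensor_mul, h, mul_one,
    Unitary.star_mul_self_of_mem (ρ.koopman g).2]

theorem repTensor_conj_mem (g : Γ) (a : HilbertTensor τP.L2 τQ.L2 →L[ℂ] HilbertTensor τP.L2 τQ.L2)
    (ha : a ∈ vnTensor (τP.stdImage P) (τQ.stdImage Q)) :
    (repTensor σ.koopman ρ.koopman g : HilbertTensor τP.L2 τQ.L2 →L[ℂ] _) * a *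
        star (repTensor σ.koopman ρ.koopman g : HilbertTensor τP.L2 τQ.L2 →L[ℂ] _) ∈
      vnTensor (τP.stdImage P) (τQ.stdImage Q) := by
  refine conj_mem_of_mem_vnGenerated _ ?_ ha
  rintro _ ⟨a, ha, b, hb, rfl⟩
  obtain ⟨a, rfl⟩ := τP.mem_stdImage_self.1 ha
  obtain ⟨b, rfl⟩ := τQ.mem_stdImage_self.1 hb
  rw [repTensor_conj]
  exact opTensor_mem_vnTensor (τP.stdRep_mem_stdImage _) (τQ.stdRep_mem_stdImage _)

theorem repTensor_vac (g : Γ) :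
    (repTensor σ.koopman ρ.koopman g : HilbertTensor τP.L2 τQ.L2 →L[ℂ] _)
      (pureTensor τP.vac τQ.vac) = pureTensor τP.vac τQ.vac := by
  rw [coe_repTensor_koopman, opTensor_pureTensor, σ.koopman_vac, ρ.koopman_vac]

theorem isTraceVector_crossedProduct_vnTensor :
    IsTraceVector (crossedProduct (vnTensor (τP.stdImage P) (τQ.stdImage Q))
      (repTensor σ.koopman ρ.koopman)) (fiber 1 (pureTensor τP.vac τQ.vac)) :=
  isTraceVector_crossedProduct (repTensor_conj_mem σ ρ) (repTensor_vac σ ρ)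
    (mem_rightBoundedClosure_vnTensor τP τQ)

variable {σ}

/-- The relative commutant of `P` in `(P ⊗̄ Q) ⋊ Γ` is `Q`. -/
theorem exists_eq_of_commutes (hP : P.IsFactor) (hσ : σ.IsOuter)
    {x : L2Group Γ (HilbertTensor τP.L2 τQ.L2) →L[ℂ] L2Group Γ (HilbertTensor τP.L2 τQ.L2)}
    (hx : x ∈ crossedProduct (vnTensor (τP.stdImage P) (τQ.stdImage Q))
      (repTensor σ.koopman ρ.koopman))
    (hc : ∀ a, twistTranslate (opTensor (τP.stdRep a) 1) 1 * x =
      x * twistTranslate (opTensor (τP.stdRep a) 1) 1) :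
    ∃ q, x = twistTranslate (opTensor 1 (τQ.stdRep q)) 1 := by
  have hbA := coefficient_mem (repTensor_conj_mem σ ρ) hx
  have hbs : ∀ s a, opTensor (τP.stdRep (σ.aut s⁻¹ a)) 1 *
      coefficient (repTensor σ.koopman ρ.koopman) x s =
      coefficient (repTensor σ.koopman ρ.koopman) x s * opTensor (τP.stdRep a) 1 := by
    intro s a
    rw [← repTensor_star_conj σ ρ]
    exact coefficient_commutes (hc a) s
  -- The automorphism in the relation for the coefficient at s is σ at s⁻¹, which is outer since s⁻¹
  -- ≠ 1.
  have hb0 : ∀ s, s ≠ 1 → coefficient (repTensor σ.koopman ρ.koopman) x s = 0 := fun s hs =>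
    eq_zero_of_twisted_commutes hσ hP (inv_ne_one.2 hs) (hbA s) (hbs s)
  obtain ⟨q, hq⟩ := exists_eq_one_tensor hP (hbA 1) fun a => by
    have h1 : σ.aut (1 : Γ)⁻¹ a = a := by rw [inv_one, map_one]; rfl
    have h2 := hbs 1 a
    rwa [h1] at h2
  refine ⟨q, ?_⟩
  rw [← hq]
  exact eq_twistTranslate_of_coefficient (isTraceVector_crossedProduct_vnTensor σ ρ) hx hb0 (hbA 1)

end RelativeCommutant

/-! ### Intermediate algebras and the conclusion -/

section Intermediate

/-- For x ∈ N let z = x - E_R(x), still in N. Moving d across the inner product and replacing y by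
its expectation n onto N gives ⟨dyΩ, zΩ⟩ = ⟨dnΩ, zΩ⟩, which vanishes because dn ∈ R. Totality then
gives zΩ = 0. -/
theorem IsTraceVector.le_of_expectation {H : Type u} [NormedAddCommGroup H] [InnerProductSpace ℂ H]
    [CompleteSpace H] {M N R : VonNeumannAlgebra H} {Ω : H} (h : IsTraceVector M Ω) (hN : N ≤ M)
    (hR : R ≤ N) {D Y : Set (H →L[ℂ] H)} (hD : ∀ d ∈ D, d ∈ R) (hY : ∀ y ∈ Y, y ∈ M)
    (hE : ∀ y ∈ Y, ∀ n ∈ N, (∀ k ∈ N, inner ℂ (k Ω) (n Ω) = inner ℂ (k Ω) (y Ω)) → n ∈ R)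
    (htot : ∀ f : H, (∀ d ∈ D, ∀ y ∈ Y, inner ℂ (d (y Ω)) f = 0) → f = 0) : N ≤ R := by
  intro x hx
  obtain ⟨r, hr, hrx⟩ := h.exists_expectation (hR.trans hN) (hN hx)
  have hz : x - r ∈ N := sub_mem hx (hR hr)
  have h0 : (x - r) Ω = 0 := by
    refine htot _ fun d hd y hy => ?_
    obtain ⟨n, hn, hny⟩ := h.exists_expectation hN (hY y hy)
    have h1 := hrx (d * n) (mul_mem (hD d hd) (hE y hy n hn hny))
    have h2 := hny (star d * (x - r)) (mul_mem (star_mem (hR (hD d hd))) hz)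
    rw [mul_apply_eq_comp, inner_star_left, inner_star_left] at h2
    rw [← inner_conj_symm, ← h2, inner_conj_symm, sub_apply, inner_sub_right, sub_eq_zero]
    exact h1.symm
  rw [sub_eq_zero.1 (h.eq_zero_of_apply_eq_zero (hN hz) h0)]
  exact hr

variable {H : Type u} [NormedAddCommGroup H] [InnerProductSpace ℂ H] [CompleteSpace H]
  {K : Type v} [NormedAddCommGroup K] [InnerProductSpace ℂ K] [CompleteSpace K]
  {P : VonNeumannAlgebra H} {Q : VonNeumannAlgebra K}
  {τP : FaithfulNormalTrace P} {τQ : FaithfulNormalTrace Q}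

theorem eq_zero_of_inner_fiber_hat {Γ : Type w}
    {f : L2Group Γ (HilbertTensor τP.L2 τQ.L2)}
    (h : ∀ g a b, inner ℂ (fiber g (pureTensor (τP.hat a) (τQ.hat b))) f = 0) : f = 0 := by
  ext g
  refine eq_zero_of_inner_pureTensor fun v w => ?_
  refine (τP.dense_hat.prodMap τQ.dense_hat).induction_on (p := fun p : τP.L2 × τQ.L2 =>
    inner ℂ (pureTensor p.1 p.2) (f g) = 0) (v, w)
    (isClosed_eq (continuous_pureTensor.inner continuous_const) continuous_const) fun p => ?_
  have := h g p.1 p.2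
  rwa [inner_fiber] at this

variable {Γ : Type w} [Group Γ]

/-- The copy of `a ∈ P` in the crossed product. -/
def leftEmbedding (Γ : Type w) [Group Γ] (τP : FaithfulNormalTrace P) (τQ : FaithfulNormalTrace Q)
    (a : P.Elt) :
    L2Group Γ (HilbertTensor τP.L2 τQ.L2) →L[ℂ] L2Group Γ (HilbertTensor τP.L2 τQ.L2) :=
  twistTranslate (opTensor (τP.stdRep a) 1) 1

/-- The copy of `b ∈ Q` in the crossed product. -/
def rightEmbedding (Γ : Type w) [Group Γ] (τP : FaithfulNormalTrace P) (τQ : FaithfulNormalTrace Q)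
    (b : Q.Elt) :
    L2Group Γ (HilbertTensor τP.L2 τQ.L2) →L[ℂ] L2Group Γ (HilbertTensor τP.L2 τQ.L2) :=
  twistTranslate (opTensor 1 (τQ.stdRep b)) 1

theorem leftEmbedding_commutes_rightEmbedding (a : P.Elt) (b : Q.Elt) :
    leftEmbedding Γ τP τQ a * rightEmbedding Γ τP τQ b =
      rightEmbedding Γ τP τQ b * leftEmbedding Γ τP τQ a := by
  rw [leftEmbedding, rightEmbedding, twistTranslate_mul, twistTranslate_mul, ← opTensor_mul,
    ← opTensor_mul]
  simp only [mul_one, one_mul]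

/-- The canonical unitary of the crossed product. -/
def crossedUnitary (σ : TraceAction Γ τP) (ρ : TraceAction Γ τQ) (g : Γ) :
    L2Group Γ (HilbertTensor τP.L2 τQ.L2) →L[ℂ] L2Group Γ (HilbertTensor τP.L2 τQ.L2) :=
  twistTranslate (repTensor σ.koopman ρ.koopman g : HilbertTensor τP.L2 τQ.L2 →L[ℂ] _) g

variable (σ : TraceAction Γ τP) (ρ : TraceAction Γ τQ)

theorem crossedUnitary_conj (g : Γ) (b : Q.Elt) :
    crossedUnitary σ ρ g * rightEmbedding Γ τP τQ b * star (crossedUnitary σ ρ g) =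
      rightEmbedding Γ τP τQ (ρ.aut g b) := by
  have h := repTensor_conj σ ρ g 1 b
  have h1 : σ.aut g 1 = 1 := map_one (σ.aut g)
  rw [h1, map_one τP.stdRep] at h
  exact (twistTranslate_conj _ _ g).trans (congrArg (fun T => twistTranslate T (1 : Γ)) h)

theorem apply_vac (g : Γ) (a : P.Elt) (b : Q.Elt) :
    (leftEmbedding Γ τP τQ a * crossedUnitary σ ρ g)
        (rightEmbedding Γ τP τQ b (fiber 1 (pureTensor τP.vac τQ.vac))) =
      fiber g (pureTensor (τP.hat a) (τQ.hat (ρ.aut g b))) := by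
  rw [mul_apply_eq_comp, rightEmbedding, crossedUnitary, leftEmbedding, twistTranslate_fiber,
    twistTranslate_fiber, twistTranslate_fiber, one_mul, one_mul, mul_one, coe_repTensor_koopman,
    opTensor_pureTensor, opTensor_pureTensor, opTensor_pureTensor, τQ.stdRep_vac, ρ.koopman_hat]
  change fiber g (pureTensor (τP.stdRep a ((σ.koopman g : τP.L2 →L[ℂ] τP.L2) τP.vac)) _) = _
  rw [σ.koopman_vac, τP.stdRep_vac]
  rfl

/-- The elements of `Q` whose copy in the crossed product lies in `N`. -/
def rightPart (τP : FaithfulNormalTrace P) (τQ : FaithfulNormalTrace Q)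
    (N : VonNeumannAlgebra (L2Group Γ (HilbertTensor τP.L2 τQ.L2))) : Set Q.Elt :=
  {b | rightEmbedding Γ τP τQ b ∈ N}

variable {N : VonNeumannAlgebra (L2Group Γ (HilbertTensor τP.L2 τQ.L2))}

theorem twistTranslate_one_tensor_mem {c : τQ.L2 →L[ℂ] τQ.L2}
    (hc : c ∈ vnGenerated (τQ.stdRep '' rightPart τP τQ N)) :
    twistTranslate (opTensor (1 : τP.L2 →L[ℂ] τP.L2) c) 1 ∈ N := by
  refine twistTranslate_mem_of_mem_vnGenerated ?_ (opTensor_one_mem_of_mem_vnGenerated hc)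
  rintro _ ⟨_, ⟨b, hb, rfl⟩, rfl⟩
  exact hb

/-- The bicommutant on K adds no new elements of Q: normality of the standard representation carries
it to L²(Q), and amplification carries it into N. -/
theorem mem_vnGenerated_rightPart {b : Q.Elt} :
    (b : K →L[ℂ] K) ∈ vnGenerated (Subtype.val '' rightPart τP τQ N) ↔
      rightEmbedding Γ τP τQ b ∈ N :=
  ⟨fun hb => twistTranslate_one_tensor_mem (τQ.stdRep_mem_vnGenerated hb),
    fun hb => subset_vnGenerated ⟨b, hb, rfl⟩⟩

theorem stdImage_rightPart_le :
    τQ.stdImage (vnGenerated (Subtype.val '' rightPart τP τQ N)) ≤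
      vnGenerated (τQ.stdRep '' rightPart τP τQ N) := by
  refine vnGenerated_le ?_
  rintro _ ⟨a, ha, rfl⟩
  exact τQ.stdRep_mem_vnGenerated ha

theorem vnGenerated_rightPart_le : vnGenerated (Subtype.val '' rightPart τP τQ N) ≤ Q := by
  refine vnGenerated_le ?_
  rintro _ ⟨b, -, rfl⟩
  exact b.2

theorem crossedProduct_rightPart_le
    (hP : ∀ a ∈ τP.stdImage P, twistTranslate (opTensor a (1 : τQ.L2 →L[ℂ] τQ.L2)) 1 ∈ N)
    (hU : ∀ g, crossedUnitary σ ρ g ∈ N) :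
    crossedProduct (vnTensor (τP.stdImage P)
      (τQ.stdImage (vnGenerated (Subtype.val '' rightPart τP τQ N))))
      (repTensor σ.koopman ρ.koopman) ≤ N := by
  refine crossedProduct_le (fun a ha => twistTranslate_mem_of_mem_vnGenerated ?_ ha) hU
  rintro _ ⟨a, ha, c, hc, rfl⟩
  rw [opTensor_eq_mul, ← mul_one (1 : Γ), ← twistTranslate_mul]
  exact mul_mem (hP a ha) (twistTranslate_one_tensor_mem (stdImage_rightPart_le hc))

variable {σ} in
theorem le_crossedProduct_rightPart (hfac : P.IsFactor) (hσ : σ.IsOuter)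
    (hP : ∀ a ∈ τP.stdImage P, twistTranslate (opTensor a (1 : τQ.L2 →L[ℂ] τQ.L2)) 1 ∈ N)
    (hU : ∀ g, crossedUnitary σ ρ g ∈ N)
    (hN : N ≤ crossedProduct (vnTensor (τP.stdImage P) (τQ.stdImage Q))
      (repTensor σ.koopman ρ.koopman)) :
    N ≤ crossedProduct (vnTensor (τP.stdImage P)
      (τQ.stdImage (vnGenerated (Subtype.val '' rightPart τP τQ N))))
      (repTensor σ.koopman ρ.koopman) := by
  have hT := isTraceVector_crossedProduct_vnTensor σ ρ
  refine hT.le_of_expectation hN (crossedProduct_rightPart_le σ ρ hP hU)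
    (D := {d | ∃ a g, d = leftEmbedding Γ τP τQ a * crossedUnitary σ ρ g})
    (Y := Set.range (rightEmbedding Γ τP τQ)) ?_ ?_ ?_ ?_
  · rintro _ ⟨a, g, rfl⟩
    exact mul_mem (twistTranslate_mem_crossedProduct
      (opTensor_mem_vnTensor (τP.stdRep_mem_stdImage a) (one_mem _)))
      (canonicalUnitary_mem_crossedProduct g)
  · rintro _ ⟨b, rfl⟩
    exact twistTranslate_mem_crossedProduct
      (opTensor_mem_vnTensor (one_mem _) (τQ.stdRep_mem_stdImage b))
  · rintro _ ⟨b, rfl⟩ n hn hnb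
    -- The expectation n of b onto N commutes with P because b does, so it comes from Q; being in N,
    -- it comes from Q₀.
    obtain ⟨q, rfl⟩ := exists_eq_of_commutes ρ hfac hσ (hN hn) fun a =>
      hT.expectation_commutes hN (twistTranslate_mem_crossedProduct
        (opTensor_mem_vnTensor (one_mem _) (τQ.stdRep_mem_stdImage b))) hn hnb
        (hP _ (τP.stdRep_mem_stdImage a)) (leftEmbedding_commutes_rightEmbedding a b)
    exact twistTranslate_mem_crossedProduct (opTensor_mem_vnTensor (one_mem _)
      (subset_vnGenerated ⟨q, mem_vnGenerated_rightPart.2 hn, rfl⟩))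
  · refine fun f hf => eq_zero_of_inner_fiber_hat fun g a b => ?_
    -- Since u_g turns b into ρ_g(b), the vector to be reached is produced from the preimage of b
    -- under ρ_g.
    obtain ⟨b, rfl⟩ : ∃ b', ρ.aut g b' = b := (ρ.aut g).surjective b
    rw [← apply_vac σ ρ]
    exact hf _ ⟨a, g, rfl⟩ _ ⟨b, rfl⟩

end Intermediate

theorem mainTheorem12 {Γ : Type w} [Group Γ]
    {H : Type u} [NormedAddCommGroup H] [InnerProductSpace ℂ H] [CompleteSpace H]
    {K : Type v} [NormedAddCommGroup K] [InnerProductSpace ℂ K] [CompleteSpace K]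
    (P : VonNeumannAlgebra H) (hP : P.IsIIOneFactor) (τP : FaithfulNormalTrace P)
    (Q : VonNeumannAlgebra K) (τQ : FaithfulNormalTrace Q)
    (hQ : TopologicalSpace.SeparableSpace τQ.L2)
    (σ : TraceAction Γ τP) (hσ : σ.IsOuter) (ρ : TraceAction Γ τQ)
    (N : VonNeumannAlgebra (L2Group Γ (HilbertTensor τP.L2 τQ.L2)))
    (hPN : crossedProduct (vnTensorOne (τP.stdImage P) τQ.L2)
      (repTensor σ.koopman ρ.koopman) ≤ N)
    (hNQ : N ≤ crossedProduct (vnTensor (τP.stdImage P) (τQ.stdImage Q))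
      (repTensor σ.koopman ρ.koopman)) :
    ∃ Q₀ : VonNeumannAlgebra K, Q₀ ≤ Q ∧
      (∀ (g : Γ) (b : Q.Elt), (b : K →L[ℂ] K) ∈ Q₀ → (ρ.aut g b : K →L[ℂ] K) ∈ Q₀) ∧
      N = crossedProduct (vnTensor (τP.stdImage P) (τQ.stdImage Q₀))
        (repTensor σ.koopman ρ.koopman) := by
  have hP1 : ∀ a ∈ τP.stdImage P, twistTranslate (opTensor a (1 : τQ.L2 →L[ℂ] τQ.L2)) 1 ∈ N :=
    fun a ha => hPN (twistTranslate_mem_crossedProduct (subset_vnGenerated ⟨a, ha, rfl⟩))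
  have hU : ∀ g, crossedUnitary σ ρ g ∈ N := fun g => hPN (canonicalUnitary_mem_crossedProduct g)
  refine ⟨vnGenerated (Subtype.val '' rightPart τP τQ N), vnGenerated_rightPart_le,
    fun g b hb => ?_, le_antisymm (le_crossedProduct_rightPart ρ hP.isFactor hσ hP1 hU hNQ)
      (crossedProduct_rightPart_le σ ρ hP1 hU)⟩
  rw [mem_vnGenerated_rightPart] at hb ⊢
  rw [← crossedUnitary_conj σ ρ]
  exact mul_mem (mul_mem (hU g) hb) (star_mem (hU g))

end
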